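/- Let $(X,\langle\cdot|\cdot\rangle)$ be a non-trivial complex Hilbert space with norm $\|\cdot\|$, and let $A:D(A)\to X$ be a densely defined self-adjoint operator in $X$ such that, for some $\varepsilon>0$, $\langle\xi|A\xi\rangle\ge\varepsilon\langle\xi|\xi\rangle$ for all $\xi\in D(A)$. Let $A^{1/2}$, with domain $D(A^{1/2})$, be the positive self-adjoint square root of $A$. Let $B,C:D(A^{1/2})\to X$ be linear maps such that, for some $a\in[0,1)$ and some $b,c,d\in\mathbb R$, $$\|B\xi\|^2\le a^2\|A^{1/2}\xi\|^2+b^2\|\xi\|^2,\qquad \|C\xi\|^2\le c^2\|A^{1/2}\xi\|^2+d^2\|\xi\|^2$$ for all $\xi\in D(A^{1/2})$. Assume that $iB$ is quasi-accretive, i.e. that there is $\omega\in\mathbb R$ with $\operatorname{Re}\langle\xi|iB\xi\rangle\ge-\omega\langle\xi|\xi\rangle$ for all $\xi\in D(A^{1/2})$ (it is not assumed that $B$ is symmetric or bounded). Let $Y:=D(A^{1/2})\times X$ with inner product $(\xi|\eta):=\langle A^{1/2}\xi_1|A^{1/2}\eta_1\rangle+\langle\xi_2|\eta_2\rangle$ and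 induced norm (and operator norm) $|\cdot|$. On $D(H):=D(A)\times D(A^{1/2})\subseteq Y$ let $H\xi:=(-i\xi_2,iA\xi_1)$ and $\hat B\xi:=(0,-B\xi_2)$, let $V\xi:=(0,iC\xi_1)$ for $\xi\in Y$, and let $G_+:=-i(H+\hat B+V)$, with domain $D(H)$. Then $G_+$ is the infinitesimal generator of a strongly continuous semigroup $T_+:[0,\infty)\to L(Y,Y)$, in the sign convention $T_+(t)=e^{-tG_+}$: $D(G_+)$ is the set of all $\xi\in Y$ for which $\lim_{t\to0+}t^{-1}(\xi-T_+(t)\xi)$ exists in $Y$, and $G_+\xi$ is this limit. Moreover, if $\mu_+\in\mathbb R$ is such that $\operatorname{Re}(\xi|G_+\xi)\ge-\mu_+(\xi|\xi)$ for all $\xi\in D(H)$, then the spectrum of $G_+$ is contained in the half-plane $[-\mu_+,\infty)\times\mathbb R=\{\lambda\in\mathbb C:\operatorname{Re}\lambda\ge-\mu_+\}$, and $|T_+(t)|\le\exp(\mu_+t)$ for all $t\in[0,\infty)$. -/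

import Mathlib

noncomputable section

namespace SecondOrderEvolution

section SquareRoot

variable {X : Type*} [NormedAddCommGroup X] [InnerProductSpace ℂ X] [CompleteSpace X]

/-- `A` is a (densely defined) self-adjoint operator in `X` which is bounded from below by some
`ε > 0`. Here `IsSelfAdjoint A` is equality of `A` with its Hilbert space adjoint; it entails
that the domain of `A` is dense. -/
structure IsStrictlyPositiveSelfAdjoint (A : X →ₗ.[ℂ] X) : Prop where
  isSelfAdjoint : IsSelfAdjoint A
  bound : ∃ ε : ℝ, 0 < ε ∧
    ∀ ξ : A.domain, ε * ‖(ξ : X)‖ ^ 2 ≤ (inner ℂ (ξ : X) (A ξ)).re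

/-- `S` is a positive self-adjoint operator with `S ∘ S = A` (including equality of domains). -/
structure IsPositiveSqrt (A S : X →ₗ.[ℂ] X) : Prop where
  isSelfAdjoint : IsSelfAdjoint S
  nonneg : ∀ ξ : S.domain, 0 ≤ (inner ℂ (ξ : X) (S ξ)).re
  comp_self : ∀ ξ η : X,
    (ξ, η) ∈ A.graph ↔ ∃ ζ : X, (ξ, ζ) ∈ S.graph ∧ (ζ, η) ∈ S.graph

theorem isSymmetric_of_isSelfAdjoint {T : X →ₗ.[ℂ] X} (hT : IsSelfAdjoint T)
    (x y : T.domain) : inner ℂ (T x) (y : X) = inner ℂ (x : X) (T y) := by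
  have h := LinearPMap.adjoint_isFormalAdjoint (T := T) hT.dense_domain
  rw [LinearPMap.isSelfAdjoint_def.mp hT] at h
  exact h x y

theorem IsStrictlyPositiveSelfAdjoint.norm_le {A : X →ₗ.[ℂ] X}
    (hA : IsStrictlyPositiveSelfAdjoint A) :
    ∃ ε : ℝ, 0 < ε ∧ ∀ ξ : A.domain, ε * ‖(ξ : X)‖ ≤ ‖A ξ‖ := by
  obtain ⟨ε, hε, h⟩ := hA.bound
  refine ⟨ε, hε, fun ξ => ?_⟩
  have h1 := h ξ
  have h2 : (inner ℂ (ξ : X) (A ξ)).re ≤ ‖(ξ : X)‖ * ‖A ξ‖ :=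
    (Complex.re_le_norm _).trans (norm_inner_le_norm _ _)
  rcases (norm_nonneg (ξ : X)).eq_or_lt with h0 | h0
  · rw [← h0]; simp
  · have : ‖(ξ : X)‖ * (ε * ‖(ξ : X)‖) ≤ ‖(ξ : X)‖ * ‖A ξ‖ := by nlinarith
    exact le_of_mul_le_mul_left this h0

theorem IsStrictlyPositiveSelfAdjoint.injective {A : X →ₗ.[ℂ] X}
    (hA : IsStrictlyPositiveSelfAdjoint A) : Function.Injective A.toFun := by
  obtain ⟨ε, hε, h⟩ := hA.norm_le
  rw [injective_iff_map_eq_zero]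
  intro ξ hξ
  have h1 := h ξ
  have h2 : A ξ = 0 := hξ
  rw [h2, norm_zero] at h1
  have h3 : ‖(ξ : X)‖ = 0 := le_antisymm (by nlinarith [norm_nonneg (ξ : X)]) (norm_nonneg _)
  exact Subtype.ext (norm_eq_zero.mp h3)

theorem IsStrictlyPositiveSelfAdjoint.surjective {A : X →ₗ.[ℂ] X}
    (hA : IsStrictlyPositiveSelfAdjoint A) : Function.Surjective A.toFun := by
  obtain ⟨ε, hε, h⟩ := hA.norm_le
  have hcl : IsClosed (A.graph : Set (X × X)) := hA.isSelfAdjoint.isClosed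
  have : CompleteSpace A.graph := hcl.completeSpace_coe
  let p : A.graph →ₗ[ℂ] X := (LinearMap.snd ℂ X X).comp A.graph.subtype
  have hp : Continuous p := continuous_snd.comp continuous_subtype_val
  have hanti : AntilipschitzWith (max ε⁻¹ 1).toNNReal p := by
    refine AddMonoidHomClass.antilipschitz_of_bound p ?_
    rintro ⟨⟨x, y⟩, hxy⟩
    obtain ⟨z, hz1, hz2⟩ := (LinearPMap.mem_graph_iff A).mp hxy
    simp only at hz1 hz2
    subst hz1 hz2
    have hz := h z
    have hm : (0 : ℝ) ≤ max ε⁻¹ 1 := le_max_of_le_right zero_le_one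
    rw [Real.coe_toNNReal _ hm]
    change max ‖(z : X)‖ ‖A z‖ ≤ max ε⁻¹ 1 * ‖A z‖
    refine max_le ?_ ?_
    · calc ‖(z : X)‖ = ε⁻¹ * (ε * ‖(z : X)‖) := by field_simp
        _ ≤ ε⁻¹ * ‖A z‖ := by gcongr
        _ ≤ _ := by gcongr; exact le_max_left _ _
    · exact le_mul_of_one_le_left (norm_nonneg _) (le_max_right _ _)
  have hup : UniformContinuous p :=
    uniformContinuous_snd.comp uniformContinuous_subtype_val
  have hrange : IsClosed (Set.range p) := hanti.isClosed_range hup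
  have hset : Set.range p = (LinearMap.range A.toFun : Set X) := by
    ext y
    constructor
    · rintro ⟨⟨⟨x, y'⟩, hxy⟩, rfl⟩
      obtain ⟨z, hz1, hz2⟩ := (LinearPMap.mem_graph_iff A).mp hxy
      exact ⟨z, hz2⟩
    · rintro ⟨z, rfl⟩
      exact ⟨⟨_, LinearPMap.mem_graph A z⟩, rfl⟩
  rw [hset] at hrange
  have : CompleteSpace (LinearMap.range A.toFun) := hrange.completeSpace_coe
  rw [← LinearMap.range_eq_top, ← Submodule.orthogonal_eq_bot_iff, Submodule.eq_bot_iff]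
  intro y hy
  have h0 : ∀ x : A.domain, inner ℂ (0 : X) (x : X) = inner ℂ y (A x) := by
    intro x
    rw [inner_zero_left]
    exact ((Submodule.mem_orthogonal' _ _).mp hy _ ⟨x, rfl⟩).symm
  have hmem : y ∈ A.adjoint.domain := LinearPMap.mem_adjoint_domain_of_exists y ⟨0, h0⟩
  have hval : A.adjoint ⟨y, hmem⟩ = 0 :=
    LinearPMap.adjoint_apply_eq hA.isSelfAdjoint.dense_domain ⟨y, hmem⟩ h0
  have hg : (y, (0 : X)) ∈ A.adjoint.graph :=
    (LinearPMap.mem_graph_iff _).mpr ⟨⟨y, hmem⟩, rfl, hval⟩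
  rw [LinearPMap.isSelfAdjoint_def.mp hA.isSelfAdjoint] at hg
  obtain ⟨z, hz1, hz2⟩ := (LinearPMap.mem_graph_iff A).mp hg
  have hz3 : z = 0 := (injective_iff_map_eq_zero A.toFun).mp hA.injective z hz2
  simp only at hz1
  rw [← hz1, hz3]; rfl

/-- A bijective positive self-adjoint operator has a bounded positive inverse. -/
theorem exists_bounded_inverse {T : X →ₗ.[ℂ] X} (hT : IsSelfAdjoint T)
    (hpos : ∀ ξ : T.domain, 0 ≤ (inner ℂ (ξ : X) (T ξ)).re)
    (hbij : Function.Bijective T.toFun) :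
    ∃ R : X →L[ℂ] X, 0 ≤ R ∧ ∀ ξ η : X, (ξ, η) ∈ T.graph ↔ R η = ξ := by
  let e := LinearEquiv.ofBijective T.toFun hbij
  let R : X →ₗ[ℂ] X := T.domain.subtype.comp e.symm.toLinearMap
  have hTe : ∀ y, T (e.symm y) = y := fun y => e.apply_symm_apply y
  have hsym : R.IsSymmetric := by
    intro x y
    change inner ℂ ((e.symm x : T.domain) : X) y = inner ℂ x ((e.symm y : T.domain) : X)
    conv_lhs => rw [← hTe y]
    conv_rhs => rw [← hTe x]
    exact (isSymmetric_of_isSelfAdjoint hT _ _).symm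
  refine ⟨⟨R, hsym.continuous⟩, ?_, ?_⟩
  · rw [ContinuousLinearMap.nonneg_iff_isPositive]
    refine ⟨hsym, fun x => ?_⟩
    change 0 ≤ (inner ℂ ((e.symm x : T.domain) : X) x).re
    have h := hpos (e.symm x)
    rwa [hTe] at h
  · intro ξ η
    change _ ↔ ((e.symm η : T.domain) : X) = ξ
    constructor
    · intro h
      obtain ⟨z, hz1, hz2⟩ := (LinearPMap.mem_graph_iff T).mp h
      have : e z = η := hz2
      rw [← this, e.symm_apply_apply]
      exact hz1
    · rintro rfl
      exact (LinearPMap.mem_graph_iff T).mpr ⟨e.symm η, rfl, hTe η⟩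

/-- The inverse of an injective bounded positive operator is a positive self-adjoint operator. -/
theorem exists_unbounded_inverse {Q : X →L[ℂ] X} (hQ : 0 ≤ Q) (hinj : Function.Injective Q) :
    ∃ S : X →ₗ.[ℂ] X, IsSelfAdjoint S ∧
      (∀ ξ : S.domain, 0 ≤ (inner ℂ (ξ : X) (S ξ)).re) ∧
      ∀ ξ η : X, (ξ, η) ∈ S.graph ↔ Q η = ξ := by
  have hQp := (ContinuousLinearMap.nonneg_iff_isPositive Q).mp hQ
  let e := LinearEquiv.ofInjective (Q : X →ₗ[ℂ] X) hinj
  let S : X →ₗ.[ℂ] X := ⟨LinearMap.range (Q : X →ₗ[ℂ] X), e.symm.toLinearMap⟩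
  have hSQ : ∀ (ξ : S.domain), Q (S ξ) = ξ := fun ξ =>
    congrArg Subtype.val (e.apply_symm_apply ξ)
  have hgraph : ∀ ξ η : X, (ξ, η) ∈ S.graph ↔ Q η = ξ := by
    intro ξ η
    rw [LinearPMap.mem_graph_iff]
    constructor
    · rintro ⟨z, hz1, hz2⟩
      simp only at hz1 hz2
      rw [← hz2, hSQ, hz1]
    · rintro rfl
      refine ⟨⟨Q η, ⟨η, rfl⟩⟩, rfl, ?_⟩
      exact hinj (hSQ _)
  have hsym : ∀ x y : X, inner ℂ (Q x) y = inner ℂ x (Q y) := fun x y =>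
    hQp.isSymmetric x y
  have hdense : Dense (S.domain : Set X) := by
    have : S.domainᗮ = ⊥ := by
      rw [Submodule.eq_bot_iff]
      intro y hy
      apply hinj
      rw [map_zero, ← inner_self_eq_zero (𝕜 := ℂ), hsym]
      exact (Submodule.mem_orthogonal' _ _).mp hy _ ⟨Q y, rfl⟩
    rw [Submodule.dense_iff_topologicalClosure_eq_top]
    exact (Submodule.topologicalClosure_eq_top_iff).mpr this
  refine ⟨S, ?_, ?_, hgraph⟩
  · rw [LinearPMap.isSelfAdjoint_def]
    apply LinearPMap.eq_of_eq_graph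
    ext ⟨ξ, η⟩
    constructor
    · intro h
      obtain ⟨z, hz1, hz2⟩ := (LinearPMap.mem_graph_iff _).mp h
      simp only at hz1 hz2
      subst hz1 hz2
      rw [hgraph]
      refine ext_inner_right ℂ fun v => ?_
      have hv := LinearPMap.adjoint_isFormalAdjoint hdense z ⟨Q v, ⟨v, rfl⟩⟩
      have hSv : S ⟨Q v, ⟨v, rfl⟩⟩ = v := hinj (hSQ _)
      rw [hSv] at hv
      rw [hsym]
      exact hv
    · intro h
      obtain ⟨z, hz1, hz2⟩ := (LinearPMap.mem_graph_iff _).mp h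
      simp only at hz1 hz2
      subst hz1 hz2
      have h0 : ∀ x : S.domain, inner ℂ (S z) (x : X) = inner ℂ (z : X) (S x) := by
        intro x
        conv_lhs => rw [← hSQ x]
        conv_rhs => rw [← hSQ z]
        exact (hsym _ _).symm
      have hmem : (z : X) ∈ S.adjoint.domain :=
        LinearPMap.mem_adjoint_domain_of_exists _ ⟨_, h0⟩
      exact (LinearPMap.mem_graph_iff _).mpr
        ⟨⟨z, hmem⟩, rfl, LinearPMap.adjoint_apply_eq hdense ⟨z, hmem⟩ h0⟩
  · intro ξ
    have h := hQp.re_inner_nonneg_left (S ξ)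
    rw [hSQ] at h
    exact h

theorem IsPositiveSqrt.bijective {A S : X →ₗ.[ℂ] X} (hA : IsStrictlyPositiveSelfAdjoint A)
    (hS : IsPositiveSqrt A S) : Function.Bijective S.toFun := by
  constructor
  · rw [injective_iff_map_eq_zero]
    intro ξ hξ
    have h1 : ((ξ : X), (0 : X)) ∈ S.graph := (LinearPMap.mem_graph_iff _).mpr ⟨ξ, rfl, hξ⟩
    have h2 : ((ξ : X), (0 : X)) ∈ A.graph :=
      (hS.comp_self _ _).mpr ⟨0, h1, S.graph.zero_mem⟩
    obtain ⟨z, hz1, hz2⟩ := (LinearPMap.mem_graph_iff _).mp h2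
    have hz3 : z = 0 := (injective_iff_map_eq_zero A.toFun).mp hA.injective z hz2
    apply Subtype.ext
    simp only at hz1
    rw [← hz1, hz3]; rfl
  · intro y
    obtain ⟨x, hx⟩ := hA.surjective y
    obtain ⟨ζ, -, h⟩ := (hS.comp_self x y).mp ((LinearPMap.mem_graph_iff _).mpr ⟨x, rfl, hx⟩)
    obtain ⟨z, -, hz2⟩ := (LinearPMap.mem_graph_iff _).mp h
    exact ⟨z, hz2⟩

/-- A strictly positive self-adjoint operator has exactly one positive self-adjoint square root. -/
theorem existsUnique_positiveSqrt {A : X →ₗ.[ℂ] X} (hA : IsStrictlyPositiveSelfAdjoint A) :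
    ∃! S : X →ₗ.[ℂ] X, IsPositiveSqrt A S := by
  have hpos : ∀ ξ : A.domain, 0 ≤ (inner ℂ (ξ : X) (A ξ)).re := by
    obtain ⟨ε, hε, h⟩ := hA.bound
    exact fun ξ => le_trans (by positivity) (h ξ)
  obtain ⟨R, hR, hRg⟩ :=
    exists_bounded_inverse hA.isSelfAdjoint hpos ⟨hA.injective, hA.surjective⟩
  have hQR : CFC.sqrt R * CFC.sqrt R = R := CFC.sqrt_mul_sqrt_self R hR
  have hRinj : ∀ η, R η = 0 → η = 0 := by
    intro η h
    obtain ⟨z, hz1, hz2⟩ := (LinearPMap.mem_graph_iff _).mp ((hRg 0 η).mpr h)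
    simp only at hz1 hz2
    have : z = 0 := Subtype.ext hz1
    rw [← hz2, this, LinearPMap.map_zero]
  have hQinj : Function.Injective (CFC.sqrt R : X →L[ℂ] X) := by
    rw [injective_iff_map_eq_zero]
    intro η h
    apply hRinj
    rw [← hQR, mul_apply_eq_comp, h, map_zero]
  obtain ⟨S, hS, hSpos, hSg⟩ := exists_unbounded_inverse (Q := CFC.sqrt R) (CFC.sqrt_nonneg R) hQinj
  refine ⟨S, ⟨hS, hSpos, fun ξ η => ?_⟩, fun S' hS' => ?_⟩
  · rw [hRg, ← hQR, mul_apply_eq_comp]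
    constructor
    · intro h
      exact ⟨(CFC.sqrt R : X →L[ℂ] X) η, (hSg _ _).mpr h, (hSg _ _).mpr rfl⟩
    · rintro ⟨ζ, h1, h2⟩
      rw [(hSg _ _).mp h2, (hSg _ _).mp h1]
  · obtain ⟨Q', hQ', hQg⟩ :=
      exists_bounded_inverse hS'.isSelfAdjoint hS'.nonneg (hS'.bijective hA)
    have hsq : Q' * Q' = R := by
      ext η
      rw [mul_apply_eq_comp]
      refine ((hRg _ η).mp ((hS'.comp_self _ _).mpr ⟨Q' η, ?_, ?_⟩)).symm
      · exact (hQg _ _).mpr rfl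
      · exact (hQg _ _).mpr rfl
    have hQeq : CFC.sqrt R = Q' := CFC.sqrt_unique hsq hQ'
    apply LinearPMap.eq_of_eq_graph
    ext ⟨ξ, η⟩
    rw [hQg, hSg, hQeq]

/-- The square root `A^{1/2}`: the positive self-adjoint operator whose square is `A`. -/
def sqrtOp {A : X →ₗ.[ℂ] X} (hA : IsStrictlyPositiveSelfAdjoint A) : X →ₗ.[ℂ] X :=
  (existsUnique_positiveSqrt hA).choose

theorem sqrtOp_spec {A : X →ₗ.[ℂ] X} (hA : IsStrictlyPositiveSelfAdjoint A) :
    IsPositiveSqrt A (sqrtOp hA) :=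
  (existsUnique_positiveSqrt hA).choose_spec.1

theorem sqrtOp_injective {A : X →ₗ.[ℂ] X} (hA : IsStrictlyPositiveSelfAdjoint A) :
    Function.Injective (sqrtOp hA).toFun :=
  ((sqrtOp_spec hA).bijective hA).1

theorem domain_le_sqrtOp_domain {A : X →ₗ.[ℂ] X} (hA : IsStrictlyPositiveSelfAdjoint A) :
    A.domain ≤ (sqrtOp hA).domain := by
  intro ξ hξ
  obtain ⟨ζ, h, -⟩ := ((sqrtOp_spec hA).comp_self ξ (A ⟨ξ, hξ⟩)).mp (A.mem_graph ⟨ξ, hξ⟩)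
  exact LinearPMap.mem_domain_of_mem_graph h

end SquareRoot

section EnergySpace

variable {X : Type*} [NormedAddCommGroup X] [InnerProductSpace ℂ X] [CompleteSpace X]
  {A : X →ₗ.[ℂ] X}

/-- The vector space `D(A^{1/2})`, as a type of its own, so that it does not inherit the norm
of `X`. -/
def FormDomain (hA : IsStrictlyPositiveSelfAdjoint A) : Type _ := (sqrtOp hA).domain

variable (hA : IsStrictlyPositiveSelfAdjoint A)

instance : AddCommGroup (FormDomain hA) :=
  inferInstanceAs (AddCommGroup (sqrtOp hA).domain)

instance : Module ℂ (FormDomain hA) :=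
  inferInstanceAs (Module ℂ (sqrtOp hA).domain)

/-- The identity map from `FormDomain hA` to the subspace `D(A^{1/2})` of `X`. -/
def FormDomain.toDomain : FormDomain hA ≃ₗ[ℂ] (sqrtOp hA).domain :=
  LinearEquiv.refl ℂ (sqrtOp hA).domain

/-- The inner product `⟨A^{1/2} ξ, A^{1/2} η⟩` on `D(A^{1/2})`. -/
abbrev formCore : InnerProductSpace.Core ℂ (FormDomain hA) where
  inner ξ η := inner ℂ (sqrtOp hA (FormDomain.toDomain hA ξ))
    (sqrtOp hA (FormDomain.toDomain hA η))
  conj_inner_symm ξ η := inner_conj_symm _ _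
  re_inner_nonneg ξ := inner_self_nonneg
  add_left ξ η ζ := by
    rw [map_add, LinearPMap.map_add, inner_add_left]
  smul_left ξ η r := by
    rw [map_smul, LinearPMap.map_smul, inner_smul_left]
  definite ξ h := by
    have h1 : (sqrtOp hA).toFun (FormDomain.toDomain hA ξ) = 0 := inner_self_eq_zero.mp h
    have h2 := (injective_iff_map_eq_zero _).mp (sqrtOp_injective hA) _ h1
    exact (FormDomain.toDomain hA).map_eq_zero_iff.mp h2

instance : NormedAddCommGroup (FormDomain hA) :=
  (formCore hA).toNormedAddCommGroup

instance : InnerProductSpace ℂ (FormDomain hA) :=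
  InnerProductSpace.ofCore (formCore hA).toCore

/-- The space `Y = D(A^{1/2}) × X`, with the inner product
`(ξ | η) = ⟨A^{1/2} ξ₁, A^{1/2} η₁⟩ + ⟨ξ₂, η₂⟩`. -/
abbrev EnergySpace : Type _ := WithLp 2 (FormDomain hA × X)

theorem energySpace_inner (ξ η : EnergySpace hA) :
    inner ℂ ξ η =
      inner ℂ (sqrtOp hA (FormDomain.toDomain hA ξ.fst))
        (sqrtOp hA (FormDomain.toDomain hA η.fst)) + inner ℂ ξ.snd η.snd := rfl

/-- The underlying vector in `X` of the first component. -/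
def firstComp : EnergySpace hA →ₗ[ℂ] X :=
  (sqrtOp hA).domain.subtype ∘ₗ (FormDomain.toDomain hA).toLinearMap ∘ₗ
    LinearMap.fst ℂ (FormDomain hA) X ∘ₗ
      (WithLp.linearEquiv 2 ℂ (FormDomain hA × X)).toLinearMap

/-- The second component. -/
def secondComp : EnergySpace hA →ₗ[ℂ] X :=
  LinearMap.snd ℂ (FormDomain hA) X ∘ₗ
    (WithLp.linearEquiv 2 ℂ (FormDomain hA × X)).toLinearMap

/-- The subspace `D(H) = D(A) × D(A^{1/2})` of `Y`. -/
def domainH : Submodule ℂ (EnergySpace hA) :=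
  A.domain.comap (firstComp hA) ⊓ (sqrtOp hA).domain.comap (secondComp hA)

/-- The first component of an element of `D(H)`, as an element of `D(A)`. -/
def domainHFst : domainH hA →ₗ[ℂ] A.domain :=
  ((firstComp hA).comp (domainH hA).subtype).codRestrict A.domain fun ξ => ξ.2.1

/-- The second component of an element of `D(H)`, as an element of `D(A^{1/2})`. -/
def domainHSnd : domainH hA →ₗ[ℂ] (sqrtOp hA).domain :=
  ((secondComp hA).comp (domainH hA).subtype).codRestrict (sqrtOp hA).domain fun ξ => ξ.2.2

/-- The linear map `(ξ₁, ξ₂) ↦ (ξ₁, ξ₂)` from `D(A^{1/2}) × X` to `Y`. -/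
def pairY : (sqrtOp hA).domain × X →ₗ[ℂ] EnergySpace hA :=
  (WithLp.linearEquiv 2 ℂ (FormDomain hA × X)).symm.toLinearMap ∘ₗ
    ((FormDomain.toDomain hA).symm.toLinearMap.prodMap LinearMap.id)

/-- The operator `H (ξ₁, ξ₂) = (-i ξ₂, i A ξ₁)` in `Y` with domain `D(A) × D(A^{1/2})`. -/
def opH : EnergySpace hA →ₗ.[ℂ] EnergySpace hA where
  domain := domainH hA
  toFun := pairY hA ∘ₗ
    ((-Complex.I) • domainHSnd hA).prod (Complex.I • (A.toFun ∘ₗ domainHFst hA))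

/-- The operator `B̂ (ξ₁, ξ₂) = (0, -B ξ₂)` in `Y` with domain `D(H)`. -/
def opBhat (B : (sqrtOp hA).domain →ₗ[ℂ] X) : EnergySpace hA →ₗ.[ℂ] EnergySpace hA where
  domain := domainH hA
  toFun := pairY hA ∘ₗ (0 : domainH hA →ₗ[ℂ] (sqrtOp hA).domain).prod (-(B ∘ₗ domainHSnd hA))

/-- The operator `V (ξ₁, ξ₂) = (0, i C ξ₁)` defined on the whole of `Y`. -/
def opV (C : (sqrtOp hA).domain →ₗ[ℂ] X) : EnergySpace hA →ₗ[ℂ] EnergySpace hA :=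
  pairY hA ∘ₗ (0 : EnergySpace hA →ₗ[ℂ] (sqrtOp hA).domain).prod
    (Complex.I • (C ∘ₗ (FormDomain.toDomain hA).toLinearMap ∘ₗ
      LinearMap.fst ℂ (FormDomain hA) X ∘ₗ
        (WithLp.linearEquiv 2 ℂ (FormDomain hA × X)).toLinearMap))

/-- The operator `G₊ = -i (H + B̂ + V)` in `Y`. -/
def opGplus (B C : (sqrtOp hA).domain →ₗ[ℂ] X) : EnergySpace hA →ₗ.[ℂ] EnergySpace hA :=
  (-Complex.I) • (opH hA + opBhat hA B + (opV hA C).toPMap ⊤)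

theorem opGplus_domain (B C : (sqrtOp hA).domain →ₗ[ℂ] X) :
    (opGplus hA B C).domain = domainH hA := by
  change (domainH hA ⊓ domainH hA) ⊓ ⊤ = domainH hA
  simp

end EnergySpace

section Operators

variable {E : Type*} [NormedAddCommGroup E] [InnerProductSpace ℂ E]

/-- `T` is quasi-accretive: `Re ⟨ξ, T ξ⟩ ≥ -ω ⟨ξ, ξ⟩` on `D(T)`, for some real `ω`. -/
def IsQuasiAccretive (T : E →ₗ.[ℂ] E) : Prop :=
  ∃ ω : ℝ, ∀ ξ : T.domain, -ω * ‖(ξ : E)‖ ^ 2 ≤ (inner ℂ (ξ : E) (T ξ)).re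

/-- `z` is in the resolvent set of `T`: the operator `T - z` is a bijection of `D(T)` onto the
whole space with an everywhere defined bounded inverse `R`. -/
def IsResolventValue (T : E →ₗ.[ℂ] E) (z : ℂ) : Prop :=
  ∃ R : E →L[ℂ] E,
    (∀ η : E, ∃ h : R η ∈ T.domain, T ⟨R η, h⟩ - z • R η = η) ∧
    ∀ ξ : T.domain, R (T ξ - z • (ξ : E)) = ξ

/-- The spectrum of an operator in `E`. -/
def opSpectrum (T : E →ₗ.[ℂ] E) : Set ℂ := {z | ¬ IsResolventValue T z}

/-- A strongly continuous semigroup of bounded linear operators, indexed by `[0, ∞)`. -/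
structure IsStronglyContinuousSemigroup (T : NNReal → E →L[ℂ] E) : Prop where
  zero : T 0 = 1
  add : ∀ s t : NNReal, T (s + t) = T s * T t
  continuous : ∀ ξ : E, Continuous fun t => T t ξ

/-- `G` is the infinitesimal generator of `T`, in the sign convention `T t = exp (-t G)`: the
domain of `G` consists of those `ξ` for which `t⁻¹ (ξ - T t ξ)` converges as `t → 0+`, and `G ξ`
is the limit. -/
def IsInfinitesimalGenerator (G : E →ₗ.[ℂ] E) (T : NNReal → E →L[ℂ] E) : Prop :=
  ∀ ξ η : E, (ξ, η) ∈ G.graph ↔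
    Filter.Tendsto (fun t : NNReal => (((t : ℝ) : ℂ)⁻¹) • (ξ - T t ξ))
      (nhdsWithin 0 (Set.Ioi 0)) (nhds η)

end Operators

end SecondOrderEvolution

end

/-! On `D(H)` the operator acts as `G₊(x, y) = (-y, Ax + iBy + Cx)`. The theorem follows from the
Lumer–Phillips theorem in `Y` once `G₊` is known to be quasi-accretive and `G₊ + l` to be onto for
all large real `l`.

Accretivity: in `Re (ξ|G₊ξ)` the terms `-⟨A^{1/2}x|A^{1/2}y⟩` and `⟨y|Ax⟩` cancel, `iB` contributes
at least `-ω‖y‖²`, and `C` is bounded from the form domain to `X` because `A^{1/2}` is bounded below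
(`exists_quasiAccretive_opGplus`).

Range: eliminating `y` from `(G₊ + l)(x, y) = (f, g)` leaves the quadratic pencil `(A + l² + ilB +
C)x = g + lf + iBf`. The expansion `‖(A + l²)x‖² = ‖Ax‖² + 2l²‖A^{1/2}x‖² + l⁴‖x‖²` shows that for
large `l` the map `ilB + C` is bounded relative to `A + l²` with constant `7/8`
(`norm_perturbation_le`), so a Neumann series solves the pencil. Smallness of `B` enters only here,
and no symmetry of `B` is needed.

Generation is proved by Yosida approximation: the bounded operators `l²(G + l)⁻¹ - l` commute and
tend to `-G` on `D(G)`, and their exponentials converge to the semigroup (`exists_limit_semigroup`).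
The resolvent bound `(l - μ)⁻¹` holds for every admissible `μ`; it yields both the growth bound, in
the limit `l → ∞`, and the location of the spectrum. -/

noncomputable section

namespace SecondOrderEvolution

/-! ### Exponentials of bounded operators -/

section BoundedExponentials

open NormedSpace

variable {E : Type*} [NormedAddCommGroup E] [NormedSpace ℂ E]

theorem norm_exp_clm_le (Y : E →L[ℂ] E) : ‖exp Y‖ ≤ Real.exp ‖Y‖ := by
  have hs : HasSum (fun n : ℕ => ((n.factorial : ℝ)⁻¹) * ‖Y‖ ^ n) (Real.exp ‖Y‖) := by
    rw [Real.exp_eq_exp_ℝ]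
    simpa [smul_eq_mul] using NormedSpace.exp_series_hasSum_exp' (𝕂 := ℝ) ‖Y‖
  rw [NormedSpace.exp_eq_tsum (𝕂 := ℝ)]
  refine tsum_of_norm_bounded hs fun n => ?_
  rw [norm_smul, norm_inv, Real.norm_natCast]
  gcongr
  rcases Nat.eq_zero_or_pos n with rfl | hn
  -- `E` may be trivial, so only `‖1‖ ≤ 1` is available.
  · rw [pow_zero, pow_zero]; exact ContinuousLinearMap.norm_id_le
  · exact norm_pow_le' Y hn

theorem exp_real_smul_one (c : ℝ) :
    exp (c • (1 : E →L[ℂ] E)) = Real.exp c • (1 : E →L[ℂ] E) := by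
  have h := algebraMap_exp_comm (𝕂 := ℝ) (𝔸 := E →L[ℂ] E) c
  rw [Algebra.algebraMap_eq_smul_one, Algebra.algebraMap_eq_smul_one] at h
  rw [← h, Real.exp_eq_exp_ℝ]

variable [CompleteSpace E]

theorem exp_add_eq_mul {Y Z : E →L[ℂ] E} (h : Commute Y Z) : exp (Y + Z) = exp Y * exp Z := by
  let _ : NormedAlgebra ℚ (E →L[ℂ] E) := NormedAlgebra.restrictScalars ℚ ℂ _
  exact exp_add_of_commute h

/-- The scalar part factors out exactly as `e^{-tc}`; bounding the norm of the whole exponent would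
lose the sign of `c`, on which the growth bound of the Yosida approximants depends. -/
theorem norm_exp_smul_sub_le (R : E →L[ℂ] E) {k c t : ℝ} (hk : 0 ≤ k) (ht : 0 ≤ t) :
    ‖exp (t • (k • R - c • (1 : E →L[ℂ] E)))‖ ≤ Real.exp (t * (k * ‖R‖ - c)) := by
  have h1 : t • (k • R - c • (1 : E →L[ℂ] E)) =
      (t * k) • R + (-(t * c)) • (1 : E →L[ℂ] E) := by
    rw [smul_sub, smul_smul, smul_smul, neg_smul, sub_eq_add_neg]
  rw [h1, exp_add_eq_mul (((Commute.one_right R).smul_left _).smul_right _), exp_real_smul_one,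
    mul_smul_comm, mul_one, norm_smul, Real.norm_of_nonneg (Real.exp_pos _).le]
  calc Real.exp (-(t * c)) * ‖exp ((t * k) • R)‖
      ≤ Real.exp (-(t * c)) * Real.exp ‖(t * k) • R‖ := by gcongr; exact norm_exp_clm_le _
    _ = _ := by
      rw [norm_smul, Real.norm_of_nonneg (mul_nonneg ht hk), ← Real.exp_add]
      ring_nf

theorem hasDerivAt_exp_smul_apply (Y : E →L[ℂ] E) (x : E) (t : ℝ) :
    HasDerivAt (fun s : ℝ => exp (s • Y) x) (exp (t • Y) (Y x)) t :=
  ((ContinuousLinearMap.apply ℂ E x).restrictScalars ℝ).hasFDerivAt.comp_hasDerivAt t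
    (hasDerivAt_exp_smul_const Y t)

/-- The curve `s ↦ exp(s(Y - Z)) exp(tZ) x` joins `exp(tZ) x` to `exp(tY) x`. By commutativity its
derivative is `exp(sY) exp((t - s)Z) (Y - Z)x`, where the two growth bounds multiply to `e^{wt}`
independently of `s`. -/
theorem norm_exp_smul_apply_sub_le {Y Z : E →L[ℂ] E} (hYZ : Commute Y Z) {w : ℝ}
    (hY : ∀ t : ℝ, 0 ≤ t → ‖exp (t • Y)‖ ≤ Real.exp (w * t))
    (hZ : ∀ t : ℝ, 0 ≤ t → ‖exp (t • Z)‖ ≤ Real.exp (w * t)) {t : ℝ} (ht : 0 ≤ t) (x : E) :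
    ‖exp (t • Y) x - exp (t • Z) x‖ ≤ Real.exp (w * t) * ‖Y x - Z x‖ * t := by
  have hcomm : Commute (Y - Z) Z := hYZ.sub_left (Commute.refl Z)
  have key : ∀ s : ℝ, exp (s • (Y - Z)) * exp (t • Z) = exp (s • Y) * exp ((t - s) • Z) := by
    intro s
    rw [← exp_add_eq_mul ((hcomm.smul_left _).smul_right _),
      ← exp_add_eq_mul ((hYZ.smul_left _).smul_right _)]
    congr 1
    module
  have hW : ∀ s : ℝ, exp (s • (Y - Z)) ((Y - Z) (exp (t • Z) x)) =
      (exp (s • Y) * exp ((t - s) • Z)) ((Y - Z) x) := by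
    intro s
    have h2 : Commute (Y - Z) (exp (t • Z)) := by
      have := (hcomm.smul_right t)
      exact Commute.exp_right this
    rw [← key, mul_apply_eq_comp, ← mul_apply_eq_comp (Y - Z), h2.eq]
    rfl
  have := norm_image_sub_le_of_norm_deriv_le_segment' (a := 0) (b := t)
    (f := fun s : ℝ => exp (s • (Y - Z)) (exp (t • Z) x))
    (C := Real.exp (w * t) * ‖Y x - Z x‖)
    (fun s _ => (hasDerivAt_exp_smul_apply (Y - Z) (exp (t • Z) x) s).hasDerivWithinAt) ?_ t
    ⟨ht, le_rfl⟩
  · have e1 : exp (t • (Y - Z)) (exp (t • Z) x) = exp (t • Y) x := by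
      rw [← mul_apply_eq_comp, key, sub_self, zero_smul, exp_zero, mul_one]
    simpa only [e1, zero_smul, exp_zero, one_apply_eq_self, sub_zero] using this
  · intro s hs
    rw [hW]
    refine (ContinuousLinearMap.le_opNorm _ _).trans ?_
    rw [sub_apply]
    gcongr
    calc _ ≤ ‖exp (s • Y)‖ * ‖exp ((t - s) • Z)‖ := norm_mul_le _ _
      _ ≤ Real.exp (w * s) * Real.exp (w * (t - s)) := by
        gcongr
        · exact hY s hs.1
        · exact hZ _ (sub_nonneg.mpr hs.2.le)
      _ = _ := by rw [← Real.exp_add]; ring_nf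

/-- Mean value inequality for `s ↦ exp(sY) x - s v`. With `v` the limit of the approximants at `x`,
it controls the difference quotient uniformly in the approximation index. -/
theorem norm_exp_smul_apply_sub_sub_le (Y : E →L[ℂ] E) (x v : E) {C t : ℝ} (ht : 0 ≤ t)
    (hC : ∀ s ∈ Set.Icc 0 t, ‖exp (s • Y) (Y x) - v‖ ≤ C) :
    ‖exp (t • Y) x - x - t • v‖ ≤ C * t := by
  have := norm_image_sub_le_of_norm_deriv_le_segment' (a := 0) (b := t)
    (f := fun s : ℝ => exp (s • Y) x - s • v) (f' := fun s => exp (s • Y) (Y x) - v)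
    (C := C) (fun s _ => ?_) (fun s hs => hC s ⟨hs.1, hs.2.le⟩) t ⟨ht, le_rfl⟩
  · simp only [zero_smul, exp_zero, one_apply_eq_self, sub_zero] at this
    rwa [sub_right_comm] at this
  · have h := (hasDerivAt_exp_smul_apply Y x s).sub ((hasDerivAt_id s).smul_const v)
    rw [one_smul] at h
    exact h.hasDerivWithinAt

end BoundedExponentials

/-! ### Limits of exponentials of commuting operators -/

section LimitSemigroup

open NormedSpace Filter Topology

variable {E : Type*} [NormedAddCommGroup E] [NormedSpace ℂ E] [CompleteSpace E]

/-- On `D` this is the estimate for commuting exponentials; the growth bound common to all `Y n`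
carries it to every `x` by density. Uniformity on `[0, τ]` makes the limit strongly continuous. -/
theorem uniform_cauchy_exp_smul {Y : ℕ → E →L[ℂ] E} (hcomm : ∀ m n, Commute (Y m) (Y n))
    {w : ℝ} (hw : 0 ≤ w) (hY : ∀ n, ∀ t : ℝ, 0 ≤ t → ‖exp (t • Y n)‖ ≤ Real.exp (w * t))
    {D : Set E} (hD : Dense D) (hconv : ∀ x ∈ D, CauchySeq fun n => Y n x)
    (x : E) {τ : ℝ} (hτ : 0 ≤ τ) {ε : ℝ} (hε : 0 < ε) :
    ∃ N, ∀ m ≥ N, ∀ n ≥ N, ∀ t ∈ Set.Icc 0 τ,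
      ‖exp (t • Y m) x - exp (t • Y n) x‖ ≤ ε := by
  set M := Real.exp (w * τ) with hM
  have hM0 : 0 < M := Real.exp_pos _
  have hexp : ∀ t ∈ Set.Icc 0 τ, Real.exp (w * t) ≤ M := fun t ht =>
    Real.exp_le_exp.mpr (mul_le_mul_of_nonneg_left ht.2 hw)
  obtain ⟨x', hx', hxx'⟩ := hD.exists_dist_lt x (ε := ε / (3 * M)) (by positivity)
  rw [dist_eq_norm] at hxx'
  obtain ⟨N, hN⟩ := Metric.cauchySeq_iff.mp (hconv x' hx') (ε / (3 * M * (τ + 1))) (by positivity)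
  refine ⟨N, fun m hm n hn t ht => ?_⟩
  have h1 : ∀ k, ‖exp (t • Y k) (x - x')‖ ≤ ε / 3 := fun k => by
    calc _ ≤ ‖exp (t • Y k)‖ * ‖x - x'‖ := ContinuousLinearMap.le_opNorm _ _
      _ ≤ M * (ε / (3 * M)) := by
        gcongr
        exact (hY k t ht.1).trans (hexp t ht)
      _ = ε / 3 := by field_simp
  have h2 : ‖exp (t • Y m) x' - exp (t • Y n) x'‖ ≤ ε / 3 := by
    have h3 := hN m hm n hn
    rw [dist_eq_norm] at h3
    calc _ ≤ Real.exp (w * t) * ‖Y m x' - Y n x'‖ * t :=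
          norm_exp_smul_apply_sub_le (hcomm m n) (hY m) (hY n) ht.1 x'
      _ ≤ M * (ε / (3 * M * (τ + 1))) * (τ + 1) := by
        have := ht.1
        gcongr
        · exact hexp t ht
        · exact ht.2.trans (by linarith)
      _ = ε / 3 := by field_simp
  have h3 : exp (t • Y m) x - exp (t • Y n) x = exp (t • Y m) (x - x') +
      (exp (t • Y m) x' - exp (t • Y n) x') - exp (t • Y n) (x - x') := by
    rw [map_sub, map_sub]; abel
  rw [h3]
  refine (norm_sub_le _ _).trans ?_
  have := norm_add_le (exp (t • Y m) (x - x')) (exp (t • Y m) x' - exp (t • Y n) x')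
  linarith [h1 m, h1 n]

/-- Trotter's approximation of a semigroup by exponentials of commuting bounded operators. -/
theorem exists_limit_semigroup {Y : ℕ → E →L[ℂ] E} (hcomm : ∀ m n, Commute (Y m) (Y n))
    {w : ℝ} (hw : 0 ≤ w) (hY : ∀ n, ∀ t : ℝ, 0 ≤ t → ‖exp (t • Y n)‖ ≤ Real.exp (w * t))
    {D : Set E} (hD : Dense D)
    (hconv : ∀ x ∈ D, CauchySeq fun n => Y n x) :
    ∃ T : NNReal → E →L[ℂ] E,
      (T 0 = 1 ∧ (∀ s t, T (s + t) = T s * T t) ∧ ∀ x, Continuous fun t => T t x) ∧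
      (∀ (t : NNReal) x, Tendsto (fun n => exp ((t : ℝ) • Y n) x) atTop (𝓝 (T t x))) ∧
      ∀ x y, Tendsto (fun n => Y n x) atTop (𝓝 y) →
        Tendsto (fun t : NNReal => (((t : ℝ) : ℂ)⁻¹) • (x - T t x)) (𝓝[>] 0) (𝓝 (-y)) := by
  have hcau := fun x (τ : ℝ) (hτ : 0 ≤ τ) (ε : ℝ) (hε : 0 < ε) =>
    uniform_cauchy_exp_smul hcomm hw hY hD hconv x hτ hε
  have hlim : ∀ (t : NNReal) (x : E), ∃ y,
      Tendsto (fun n => exp ((t : ℝ) • Y n) x) atTop (𝓝 y) := by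
    intro t x
    refine cauchySeq_tendsto_of_complete (Metric.cauchySeq_iff.mpr fun ε hε => ?_)
    obtain ⟨N, hN⟩ := hcau x t t.2 (ε / 2) (half_pos hε)
    refine ⟨N, fun m hm n hn => ?_⟩
    rw [dist_eq_norm]
    exact (hN m hm n hn t ⟨t.2, le_rfl⟩).trans_lt (half_lt_self hε)
  choose F hF using hlim
  let T : NNReal → E →L[ℂ] E := fun t =>
    continuousLinearMapOfTendsto (fun n => exp ((t : ℝ) • Y n)) (tendsto_pi_nhds.mpr (hF t))
  have hT : ∀ (t : NNReal) x, Tendsto (fun n => exp ((t : ℝ) • Y n) x) atTop (𝓝 (T t x)) := hF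
  have hunif : ∀ x (τ : ℝ), 0 ≤ τ → ∀ ε : ℝ, 0 < ε → ∃ N, ∀ n ≥ N, ∀ t : NNReal, (t : ℝ) ≤ τ →
      ‖exp ((t : ℝ) • Y n) x - T t x‖ ≤ ε := by
    intro x τ hτ ε hε
    obtain ⟨N, hN⟩ := hcau x τ hτ ε hε
    refine ⟨N, fun n hn t ht => ?_⟩
    refine le_of_tendsto ((tendsto_const_nhds.sub (hT t x)).norm) ?_
    filter_upwards [eventually_ge_atTop N] with m hm
    exact hN n hn m hm t ⟨t.2, ht⟩
  have hbd : ∀ n (t : NNReal) x, ‖exp ((t : ℝ) • Y n) x‖ ≤ Real.exp (w * t) * ‖x‖ := fun n t x =>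
    (ContinuousLinearMap.le_opNorm _ _).trans (by gcongr; exact hY n t t.2)
  have hT0 : T 0 = 1 := by
    ext x
    refine tendsto_nhds_unique (hT 0 x) ?_
    simp
  have hTcont : ∀ x, Continuous fun t => T t x := by
    intro x
    have : TendstoLocallyUniformly (fun n (t : NNReal) => exp ((t : ℝ) • Y n) x)
        (fun t => T t x) atTop := by
      rw [Metric.tendstoLocallyUniformly_iff]
      intro ε hε t
      refine ⟨Set.Iic (t + 1), Iic_mem_nhds (lt_add_one t), ?_⟩
      obtain ⟨N, hN⟩ := hunif x (t + 1) (by positivity) (ε / 2) (half_pos hε)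
      filter_upwards [eventually_ge_atTop N] with n hn s hs
      rw [dist_comm, dist_eq_norm]
      exact (hN n hn s (by exact_mod_cast hs)).trans_lt (half_lt_self hε)
    refine this.continuous (Frequently.of_forall fun n => ?_)
    have hc : Continuous fun s : ℝ => exp (s • Y n) x :=
      continuous_iff_continuousAt.mpr fun s => (hasDerivAt_exp_smul_apply (Y n) x s).continuousAt
    exact hc.comp NNReal.continuous_coe
  refine ⟨T, ⟨hT0, fun s t => ?_, hTcont⟩, hT, fun x y hxy => ?_⟩
  · ext x
    refine tendsto_nhds_unique (hT (s + t) x) ?_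
    have hadd : ∀ n, exp (((s + t : NNReal) : ℝ) • Y n) x =
        exp ((s : ℝ) • Y n) (exp ((t : ℝ) • Y n) x - T t x) + exp ((s : ℝ) • Y n) (T t x) := by
      intro n
      rw [← map_add, sub_add_cancel, NNReal.coe_add, add_smul,
        exp_add_eq_mul (((Commute.refl _).smul_left _).smul_right _), mul_apply_eq_comp]
    simp_rw [hadd]
    -- The first summand of `hadd` vanishes in the limit because `exp(s Y n)` is bounded uniformly
    -- in `n`.
    rw [mul_apply_eq_comp, ← zero_add (T s (T t x))]
    refine Tendsto.add ?_ (hT s (T t x))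
    refine squeeze_zero_norm (fun n => hbd n s _) ?_
    have : Tendsto (fun n => exp ((t : ℝ) • Y n) x - T t x) atTop (𝓝 0) := by
      simpa using (hT t x).sub_const (T t x)
    simpa using this.norm.const_mul (Real.exp (w * s))
  · rw [Metric.tendsto_nhds]
    intro ε hε
    have hg := Metric.continuousAt_iff.mp ((hTcont y).continuousAt (x := 0)) (ε / 4) (by positivity)
    obtain ⟨δ, hδ, hδ'⟩ := hg
    -- On `[0, t]` the derivative `exp(s Y n)(Y n x)` differs from `y` by at most `ε/8 + ε/8 + ε/4`:
    -- from `Y n x → y`, from `exp(s Y n) y → T s y`, and from continuity of `T s y` at `0`.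
    have hbound : ∀ t : NNReal, (t : ℝ) < δ → ‖T t x - x - (t : ℝ) • y‖ ≤ ε / 2 * t := by
      intro t ht
      set M := Real.exp (w * t)
      have hM0 : 0 < M := Real.exp_pos _
      obtain ⟨N₁, hN₁⟩ := hunif y t t.2 (ε / 8) (by positivity)
      obtain ⟨N₂, hN₂⟩ := Metric.tendsto_atTop.mp hxy (ε / (8 * M)) (by positivity)
      refine le_of_tendsto (((hT t x).sub_const x).sub_const ((t : ℝ) • y)).norm ?_
      filter_upwards [eventually_ge_atTop N₁, eventually_ge_atTop N₂] with n hn₁ hn₂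
      refine norm_exp_smul_apply_sub_sub_le (Y n) x y t.2 fun s hs => ?_
      lift s to NNReal using hs.1
      have hst : (s : ℝ) ≤ t := hs.2
      have h1 : ‖exp ((s : ℝ) • Y n) (Y n x - y)‖ ≤ ε / 8 := by
        have := hN₂ n hn₂
        rw [dist_eq_norm] at this
        calc _ ≤ Real.exp (w * s) * ‖Y n x - y‖ := hbd n s _
          _ ≤ M * (ε / (8 * M)) := by
            gcongr
            exact Real.exp_le_exp.mpr (mul_le_mul_of_nonneg_left hst hw)
          _ = ε / 8 := by field_simp
      have h2 := hN₁ n hn₁ s hst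
      have h3 : ‖T s y - y‖ ≤ ε / 4 := by
        have h4 := @hδ' s (by
          rw [NNReal.dist_eq, NNReal.coe_zero, sub_zero, abs_of_nonneg s.coe_nonneg]
          exact hst.trans_lt ht)
        rw [hT0, dist_eq_norm] at h4
        exact h4.le
      have h4 : exp ((s : ℝ) • Y n) (Y n x) - y = exp ((s : ℝ) • Y n) (Y n x - y) +
          (exp ((s : ℝ) • Y n) y - T s y) + (T s y - y) := by
        rw [map_sub]; abel
      rw [h4]
      refine (norm_add₃_le).trans ?_
      linarith
    have hnear : ∀ᶠ t : NNReal in 𝓝[>] 0, (t : ℝ) < δ := by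
      refine nhdsWithin_le_nhds ?_
      exact (NNReal.continuous_coe.tendsto 0).eventually (gt_mem_nhds hδ)
    filter_upwards [hnear, self_mem_nhdsWithin] with t ht ht0
    have ht0' : (0 : ℝ) < t := by exact_mod_cast ht0
    have htc : ((t : ℝ) : ℂ) ≠ 0 := by exact_mod_cast ht0'.ne'
    have h5 : (((t : ℝ) : ℂ)⁻¹) • (x - T t x) - -y =
        -((((t : ℝ) : ℂ)⁻¹) • (T t x - x - (t : ℝ) • y)) := by
      rw [← Complex.coe_smul (t : ℝ) y, smul_sub _ (T t x - x), inv_smul_smul₀ htc,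
        ← neg_sub x (T t x), smul_neg]
      abel
    rw [dist_eq_norm, h5, norm_neg, norm_smul, norm_inv, Complex.norm_real,
      Real.norm_of_nonneg ht0'.le]
    calc (t : ℝ)⁻¹ * ‖T t x - x - (t : ℝ) • y‖ ≤ (t : ℝ)⁻¹ * (ε / 2 * t) := by
          gcongr; exact hbound t ht
      _ = ε / 2 := by field_simp
      _ < ε := half_lt_self hε

end LimitSemigroup

/-! ### Resolvents, spectrum and generation for quasi-accretive operators -/

section Generation

open NormedSpace Filter Topology

variable {E : Type*} [NormedAddCommGroup E] [InnerProductSpace ℂ E]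

theorem re_inner_add_ofReal_smul_self (x y : E) (l : ℝ) :
    (inner ℂ x (y + (l : ℂ) • x)).re = (inner ℂ x y).re + l * ‖x‖ ^ 2 := by
  rw [inner_add_right, inner_smul_right, Complex.add_re, Complex.re_ofReal_mul]
  congr 2
  exact inner_self_eq_norm_sq (𝕜 := ℂ) x

theorem sub_mul_norm_le_of_accretive {G : E →ₗ.[ℂ] E} {μ : ℝ}
    (hμ : ∀ ξ : G.domain, -μ * ‖(ξ : E)‖ ^ 2 ≤ (inner ℂ (ξ : E) (G ξ)).re) (l : ℝ)
    (ξ : G.domain) : (l - μ) * ‖(ξ : E)‖ ≤ ‖G ξ + (l : ℂ) • (ξ : E)‖ := by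
  have h1 := re_inner_add_ofReal_smul_self (ξ : E) (G ξ) l
  have h2 : (inner ℂ (ξ : E) (G ξ + (l : ℂ) • (ξ : E))).re ≤
      ‖(ξ : E)‖ * ‖G ξ + (l : ℂ) • (ξ : E)‖ :=
    (Complex.re_le_norm _).trans (norm_inner_le_norm _ _)
  have h3 := hμ ξ
  rcases (norm_nonneg (ξ : E)).eq_or_lt with h0 | h0
  · rw [← h0, mul_zero]; exact norm_nonneg _
  · refine le_of_mul_le_mul_left ?_ h0
    nlinarith

/-- Accretivity bounds `G + l` below by `l - μ`. The constant `w` serves to construct `R`;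
quantifying over `μ` afterwards gives the same `R` the sharp bound for every admissible `μ`. -/
theorem exists_resolvent {G : E →ₗ.[ℂ] E} {w l : ℝ} (hl : w < l)
    (hacc : ∀ ξ : G.domain, -w * ‖(ξ : E)‖ ^ 2 ≤ (inner ℂ (ξ : E) (G ξ)).re)
    (hsurj : ∀ η : E, ∃ ξ : G.domain, G ξ + (l : ℂ) • (ξ : E) = η) :
    ∃ R : E →L[ℂ] E,
      (∀ η : E, ∃ h : R η ∈ G.domain, G ⟨R η, h⟩ + (l : ℂ) • R η = η) ∧
      (∀ ξ : G.domain, R (G ξ + (l : ℂ) • (ξ : E)) = ξ) ∧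
      ∀ μ : ℝ, μ < l →
        (∀ ξ : G.domain, -μ * ‖(ξ : E)‖ ^ 2 ≤ (inner ℂ (ξ : E) (G ξ)).re) →
        ‖R‖ ≤ (l - μ)⁻¹ := by
  let P : G.domain →ₗ[ℂ] E := G.toFun + (l : ℂ) • G.domain.subtype
  have hP : ∀ ξ : G.domain, P ξ = G ξ + (l : ℂ) • (ξ : E) := fun ξ => rfl
  have hinj : Function.Injective P := by
    rw [injective_iff_map_eq_zero]
    intro ξ hξ
    have h := sub_mul_norm_le_of_accretive hacc l ξ
    rw [← hP, hξ, norm_zero] at h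
    have h1 : ‖(ξ : E)‖ = 0 := le_antisymm (by nlinarith [norm_nonneg (ξ : E)]) (norm_nonneg _)
    exact Subtype.ext (norm_eq_zero.mp h1)
  let e := LinearEquiv.ofBijective P ⟨hinj, hsurj⟩
  have he : ∀ η, G (e.symm η) + (l : ℂ) • ((e.symm η : G.domain) : E) = η :=
    fun η => e.apply_symm_apply η
  have hbound : ∀ μ : ℝ, μ < l →
      (∀ ξ : G.domain, -μ * ‖(ξ : E)‖ ^ 2 ≤ (inner ℂ (ξ : E) (G ξ)).re) →
      ∀ η, ‖((e.symm η : G.domain) : E)‖ ≤ (l - μ)⁻¹ * ‖η‖ := by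
    intro μ hμl hμ η
    have h := sub_mul_norm_le_of_accretive hμ l (e.symm η)
    rw [he] at h
    rwa [le_inv_mul_iff₀ (sub_pos.mpr hμl)]
  let R : E →L[ℂ] E := (G.domain.subtype.comp e.symm.toLinearMap).mkContinuous (l - w)⁻¹
    (hbound w hl hacc)
  have hR : ∀ η, R η = ((e.symm η : G.domain) : E) := fun η => rfl
  refine ⟨R, fun η => ⟨(e.symm η).2, he η⟩, fun ξ => ?_, fun μ hμl hμ => ?_⟩
  · have : e ξ = G ξ + (l : ℂ) • (ξ : E) := rfl
    rw [← this, hR, e.symm_apply_apply]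
  · exact R.opNorm_le_bound (inv_nonneg.mpr (sub_pos.mpr hμl).le) (hbound μ hμl hμ)

/-- Neumann series: `G - z = (1 - (z + l)R)(G + l)` on `D(G)`. -/
theorem isResolventValue_of_norm_mul_lt [CompleteSpace E] {G : E →ₗ.[ℂ] E} {l : ℝ}
    {R : E →L[ℂ] E}
    (hR : ∀ η : E, ∃ h : R η ∈ G.domain, G ⟨R η, h⟩ + (l : ℂ) • R η = η)
    (hR' : ∀ ξ : G.domain, R (G ξ + (l : ℂ) • (ξ : E)) = ξ) {z : ℂ}
    (hz : ‖(z + l) • R‖ < 1) : IsResolventValue G z := by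
  let u := Units.oneSub ((z + l) • R) hz
  have hu : ∀ v, (u : E →L[ℂ] E) v = v - (z + l) • R v := fun v => rfl
  refine ⟨R * ((u⁻¹ : (E →L[ℂ] E)ˣ) : E →L[ℂ] E), fun η => ?_, fun ξ => ?_⟩
  · set v := ((u⁻¹ : (E →L[ℂ] E)ˣ) : E →L[ℂ] E) η with hv
    obtain ⟨h, hG⟩ := hR v
    refine ⟨h, ?_⟩
    have h1 : (u : E →L[ℂ] E) v = η := by
      rw [hv, ← mul_apply_eq_comp, Units.mul_inv, one_apply_eq_self]
    rw [hu] at h1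
    change G ⟨R v, h⟩ - z • R v = η
    rw [eq_sub_of_add_eq hG, ← h1, add_smul]
    abel
  · have h1 : G ξ - z • (ξ : E) = (u : E →L[ℂ] E) (G ξ + (l : ℂ) • (ξ : E)) := by
      rw [hu, hR', add_smul]
      abel
    rw [h1, mul_apply_eq_comp, ← mul_apply_eq_comp _ (u : E →L[ℂ] E), Units.inv_mul,
      one_apply_eq_self, hR']

theorem opSpectrum_subset_of_accretive [CompleteSpace E] {G : E →ₗ.[ℂ] E} {μ l₀ : ℝ}
    (hμ : ∀ ξ : G.domain, -μ * ‖(ξ : E)‖ ^ 2 ≤ (inner ℂ (ξ : E) (G ξ)).re)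
    (hsurj : ∀ l : ℝ, l₀ < l → ∀ η : E, ∃ ξ : G.domain, G ξ + (l : ℂ) • (ξ : E) = η) :
    opSpectrum G ⊆ {z : ℂ | -μ ≤ z.re} := by
  intro z hz
  by_contra hlt
  apply hz
  have hd : 0 < -(z.re + μ) := by
    have : z.re < -μ := not_le.mp hlt
    linarith
  -- The inequality `|z + l|² < (l - μ)²` reads `|z|² < 2l·(-(Re z + μ)) + μ²`, which holds for
  -- large `l` because `Re z < -μ`.
  obtain ⟨l, hl⟩ := exists_gt (max (max l₀ μ) ((z.re ^ 2 + z.im ^ 2) / (2 * -(z.re + μ))))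
  obtain ⟨⟨hl1, hl2⟩, hl3⟩ : (l₀ < l ∧ μ < l) ∧ _ := by simpa only [max_lt_iff] using hl
  rw [div_lt_iff₀ (by positivity)] at hl3
  obtain ⟨R, hR, hR', hRn⟩ := exists_resolvent hl2 hμ (hsurj l hl1)
  refine isResolventValue_of_norm_mul_lt hR hR' ?_
  have h1 : ‖z + l‖ < l - μ := by
    refine lt_of_pow_lt_pow_left₀ 2 (sub_pos.mpr hl2).le ?_
    rw [Complex.sq_norm, Complex.normSq_apply]
    simp only [Complex.add_re, Complex.ofReal_re, Complex.add_im, Complex.ofReal_im, add_zero]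
    nlinarith [sq_nonneg μ]
  calc ‖(z + l) • R‖ ≤ ‖z + l‖ * (l - μ)⁻¹ := by
        rw [norm_smul]; gcongr; exact hRn μ hl2 hμ
    _ < 1 := by
      rw [← div_eq_mul_inv, div_lt_one (sub_pos.mpr hl2)]
      exact h1

/-- If `y ⊥ D(G)` and `(G + l)ξ = y`, then `0 = Re ⟨ξ|y⟩ ≥ (l - w)‖ξ‖²`, so `ξ` and `y` vanish. -/
theorem dense_domain_of_accretive [CompleteSpace E] {G : E →ₗ.[ℂ] E} {w l : ℝ} (hl : w < l)
    (hacc : ∀ ξ : G.domain, -w * ‖(ξ : E)‖ ^ 2 ≤ (inner ℂ (ξ : E) (G ξ)).re)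
    (hsurj : ∀ η : E, ∃ ξ : G.domain, G ξ + (l : ℂ) • (ξ : E) = η) :
    Dense (G.domain : Set E) := by
  rw [Submodule.dense_iff_topologicalClosure_eq_top, Submodule.topologicalClosure_eq_top_iff,
    Submodule.eq_bot_iff]
  intro y hy
  obtain ⟨ξ, hξ⟩ := hsurj y
  have h1 : inner ℂ (ξ : E) y = 0 := (Submodule.mem_orthogonal _ _).mp hy _ ξ.2
  have h2 := re_inner_add_ofReal_smul_self (ξ : E) (G ξ) l
  rw [hξ, h1, Complex.zero_re] at h2
  have h3 := hacc ξ
  have h4 : ‖(ξ : E)‖ ^ 2 = 0 := le_antisymm (by nlinarith [sq_nonneg ‖(ξ : E)‖]) (sq_nonneg _)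
  have h5 : ξ = 0 := Subtype.ext (norm_eq_zero.mp (pow_eq_zero_iff two_ne_zero |>.mp h4))
  rw [← hξ, h5, LinearPMap.map_zero, ZeroMemClass.coe_zero, smul_zero, add_zero]

theorem commute_of_resolvent {G : E →ₗ.[ℂ] E} {k l : ℝ} {Q R : E →L[ℂ] E}
    (hQ : ∀ η : E, ∃ h : Q η ∈ G.domain, G ⟨Q η, h⟩ + (k : ℂ) • Q η = η)
    (hQ' : ∀ ξ : G.domain, Q (G ξ + (k : ℂ) • (ξ : E)) = ξ)
    (hR : ∀ η : E, ∃ h : R η ∈ G.domain, G ⟨R η, h⟩ + (l : ℂ) • R η = η)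
    (hR' : ∀ ξ : G.domain, R (G ξ + (l : ℂ) • (ξ : E)) = ξ) (hkl : k ≠ l) :
    Commute Q R := by
  -- The resolvent identity `(l - k)QR = Q - R`; exchanging the roles of `Q` and `R` gives the same
  -- value for `(l - k)RQ`.
  have key : ∀ {k l : ℝ} {Q R : E →L[ℂ] E},
      (∀ ξ : G.domain, Q (G ξ + (k : ℂ) • (ξ : E)) = ξ) →
      (∀ η : E, ∃ h : R η ∈ G.domain, G ⟨R η, h⟩ + (l : ℂ) • R η = η) →
      ∀ η, ((l : ℂ) - k) • Q (R η) = Q η - R η := by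
    intro k l Q R hQ' hR η
    obtain ⟨h, hG⟩ := hR η
    have h1 := hQ' ⟨R η, h⟩
    rw [eq_sub_of_add_eq hG] at h1
    change Q (η - (l : ℂ) • R η + (k : ℂ) • R η) = R η at h1
    rw [map_add, map_sub, map_smul, map_smul] at h1
    linear_combination (norm := module) (-1 : ℂ) • h1
  have hne : (l : ℂ) - k ≠ 0 := by
    rw [sub_ne_zero]; exact_mod_cast hkl.symm
  ext η
  rw [mul_apply_eq_comp, mul_apply_eq_comp]
  refine (smul_right_injective E hne) ?_
  change ((l : ℂ) - k) • Q (R η) = ((l : ℂ) - k) • R (Q η)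
  rw [key hQ' hR η, ← neg_sub (k : ℂ) (l : ℂ), neg_smul, key hR' hQ η, neg_sub]

/-- On `D(G)` one has `l R ξ = ξ - R(Gξ)` with `‖R‖ → 0`. The condition `l > 2w` bounds `‖l R‖` by
`2`, and density does the rest. -/
theorem tendsto_smul_resolvent {G : E →ₗ.[ℂ] E} {w : ℝ} (hw : 0 ≤ w) {l : ℕ → ℝ}
    (hl : ∀ n, 2 * w < l n) (hlim : Tendsto l atTop atTop) {R : ℕ → E →L[ℂ] E}
    (hR' : ∀ n, ∀ ξ : G.domain, R n (G ξ + (l n : ℂ) • (ξ : E)) = ξ)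
    (hRn : ∀ n, ‖R n‖ ≤ (l n - w)⁻¹) (hD : Dense (G.domain : Set E)) (y : E) :
    Tendsto (fun n => (l n : ℂ) • R n y) atTop (𝓝 y) := by
  have hbd : ∀ n x, ‖(l n : ℂ) • R n x‖ ≤ 2 * ‖x‖ := by
    intro n x
    have h1 := hl n
    have h2 : 0 < l n - w := by linarith
    rw [norm_smul, Complex.norm_real, Real.norm_of_nonneg (by linarith)]
    calc l n * ‖R n x‖ ≤ l n * ((l n - w)⁻¹ * ‖x‖) := by
          gcongr
          · linarith
          · exact ((R n).le_opNorm x).trans (by gcongr; exact hRn n)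
      _ = (l n / (l n - w)) * ‖x‖ := by ring
      _ ≤ 2 * ‖x‖ := by
        gcongr
        rw [div_le_iff₀ h2]
        linarith
  have hdom : ∀ ξ : G.domain, Tendsto (fun n => (l n : ℂ) • R n (ξ : E)) atTop (𝓝 (ξ : E)) := by
    intro ξ
    have h1 : ∀ n, (l n : ℂ) • R n (ξ : E) = ξ - R n (G ξ) := fun n => by
      rw [eq_sub_iff_add_eq, ← map_smul, ← map_add, add_comm]
      exact hR' n ξ
    simp_rw [h1]
    nth_rw 2 [← sub_zero (ξ : E)]
    refine tendsto_const_nhds.sub ?_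
    refine squeeze_zero_norm (a := fun n => (l n - w)⁻¹ * ‖G ξ‖)
      (fun n => ((R n).le_opNorm _).trans (by gcongr; exact hRn n)) ?_
    have h2 : Tendsto (fun n => (l n - w)⁻¹) atTop (𝓝 0) :=
      tendsto_inv_atTop_zero.comp (tendsto_atTop_add_const_right _ _ hlim)
    simpa using h2.mul_const ‖G ξ‖
  rw [Metric.tendsto_nhds]
  intro ε hε
  obtain ⟨x, hx, hxy⟩ := hD.exists_dist_lt y (ε := ε / 4) (by positivity)
  filter_upwards [Metric.tendsto_nhds.mp (hdom ⟨x, hx⟩) (ε / 4) (by positivity)] with n hn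
  rw [dist_eq_norm] at hn hxy ⊢
  have h1 : (l n : ℂ) • R n y - y =
      (l n : ℂ) • R n (y - x) + ((l n : ℂ) • R n x - x) - (y - x) := by
    rw [map_sub, smul_sub]; abel
  rw [h1]
  have h2 := norm_sub_le ((l n : ℂ) • R n (y - x) + ((l n : ℂ) • R n x - x)) (y - x)
  have h3 := norm_add_le ((l n : ℂ) • R n (y - x)) ((l n : ℂ) • R n x - x)
  have h4 := hbd n (y - x)
  linarith

/-- An operator whose shift is surjective is the full generator of a semigroup as soon as the
generator extends it. -/
theorem mem_graph_of_tendsto_difference_quotient {G : E →ₗ.[ℂ] E} {T : NNReal → E →L[ℂ] E}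
    {w l : ℝ} (hl : w < l) (hT : ∀ t, ‖T t‖ ≤ Real.exp (w * t))
    (hG : ∀ ξ : G.domain, Tendsto (fun t : NNReal => (((t : ℝ) : ℂ)⁻¹) • ((ξ : E) - T t ξ))
      (𝓝[>] 0) (𝓝 (G ξ)))
    (hsurj : ∀ η : E, ∃ ξ : G.domain, G ξ + (l : ℂ) • (ξ : E) = η) {x y : E}
    (hxy : Tendsto (fun t : NNReal => (((t : ℝ) : ℂ)⁻¹) • (x - T t x)) (𝓝[>] 0) (𝓝 y)) :
    (x, y) ∈ G.graph := by
  obtain ⟨ξ, hξ⟩ := hsurj (y + (l : ℂ) • x)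
  -- The generator of `T` extends `G`, so `d` is an eigenvector of it with eigenvalue `-l`. The
  -- growth bound forces the real part of the eigenvalue to be at least `-w` unless `d = 0`.
  set d := x - (ξ : E) with hd
  have hlim : Tendsto (fun t : NNReal => (((t : ℝ) : ℂ)⁻¹) • (d - T t d)) (𝓝[>] 0)
      (𝓝 (-(l : ℂ) • d)) := by
    have h1 : y - G ξ = -(l : ℂ) • d := by
      rw [eq_sub_of_add_eq hξ, hd, neg_smul, smul_sub]; abel
    rw [← h1]
    refine (hxy.sub (hG ξ)).congr fun t => ?_
    rw [← smul_sub, hd, map_sub]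
    congr 1; abel
  have hre : Tendsto (fun t : NNReal => (inner ℂ d ((((t : ℝ) : ℂ)⁻¹) • (d - T t d))).re) (𝓝[>] 0)
      (𝓝 (-l * ‖d‖ ^ 2)) := by
    have h2 : (inner ℂ d (-(l : ℂ) • d)).re = -l * ‖d‖ ^ 2 := by
      have := re_inner_add_ofReal_smul_self d 0 (-l)
      simpa using this
    rw [← h2]
    exact (Complex.continuous_re.tendsto _).comp (tendsto_const_nhds.inner hlim)
  have hlow : Tendsto (fun t : NNReal => -(w * Real.exp (w * t) * ‖d‖ ^ 2)) (𝓝[>] 0)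
      (𝓝 (-(w * ‖d‖ ^ 2))) := by
    have hc : Continuous fun t : NNReal => -(w * Real.exp (w * t) * ‖d‖ ^ 2) := by fun_prop
    have := hc.tendsto 0
    rw [NNReal.coe_zero, mul_zero, Real.exp_zero, mul_one] at this
    exact this.mono_left nhdsWithin_le_nhds
  have hle : -(w * ‖d‖ ^ 2) ≤ -l * ‖d‖ ^ 2 := by
    refine le_of_tendsto_of_tendsto hlow hre ?_
    filter_upwards [self_mem_nhdsWithin] with t ht
    have ht0 : (0 : ℝ) < t := by exact_mod_cast (show (0 : NNReal) < t from ht)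
    rw [inner_smul_right, ← Complex.ofReal_inv, Complex.re_ofReal_mul, inner_sub_right,
      Complex.sub_re]
    have h1 : (inner ℂ d d).re = ‖d‖ ^ 2 := inner_self_eq_norm_sq (𝕜 := ℂ) d
    have h2 : (inner ℂ d (T t d)).re ≤ Real.exp (w * t) * ‖d‖ ^ 2 := by
      calc (inner ℂ d (T t d)).re ≤ ‖d‖ * ‖T t d‖ :=
            (Complex.re_le_norm _).trans (norm_inner_le_norm _ _)
        _ ≤ ‖d‖ * (Real.exp (w * t) * ‖d‖) := by
          gcongr
          exact ((T t).le_opNorm d).trans (by gcongr; exact hT t)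
        _ = _ := by ring
    -- This is `1 - wt ≤ e^{-wt}` multiplied by `e^{wt}`.
    have h3 : Real.exp (w * t) - 1 ≤ w * t * Real.exp (w * t) := by
      have h4 := Real.add_one_le_exp (-(w * t))
      have h5 : Real.exp (-(w * t)) * Real.exp (w * t) = 1 := by
        rw [← Real.exp_add]; simp
      nlinarith [Real.exp_pos (w * t)]
    rw [h1, ← div_eq_inv_mul, le_div_iff₀ ht0]
    nlinarith [sq_nonneg ‖d‖]
  have h0 : ‖d‖ ^ 2 = 0 := le_antisymm (by nlinarith [sq_nonneg ‖d‖]) (sq_nonneg _)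
  have hdz : x - (ξ : E) = 0 := norm_eq_zero.mp (pow_eq_zero_iff two_ne_zero |>.mp h0)
  have hx : x = ξ := sub_eq_zero.mp hdz
  refine (LinearPMap.mem_graph_iff G).mpr ⟨ξ, hx.symm, ?_⟩
  rw [hx] at hξ
  exact add_right_cancel hξ

/-- The Lumer–Phillips theorem, for quasi-accretive operators in a Hilbert space. -/
theorem exists_semigroup_of_accretive [CompleteSpace E] {G : E →ₗ.[ℂ] E} {w l₀ : ℝ} (hw : 0 ≤ w)
    (hacc : ∀ ξ : G.domain, -w * ‖(ξ : E)‖ ^ 2 ≤ (inner ℂ (ξ : E) (G ξ)).re)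
    (hsurj : ∀ l : ℝ, l₀ < l → ∀ η : E, ∃ ξ : G.domain, G ξ + (l : ℂ) • (ξ : E) = η) :
    ∃ T : NNReal → E →L[ℂ] E, IsStronglyContinuousSemigroup T ∧ IsInfinitesimalGenerator G T ∧
      ∀ μ : ℝ, (∀ ξ : G.domain, -μ * ‖(ξ : E)‖ ^ 2 ≤ (inner ℂ (ξ : E) (G ξ)).re) →
        ∀ t : NNReal, ‖T t‖ ≤ Real.exp (μ * t) := by
  -- Starting above `2w` keeps `l / (l - w) ≤ 2`, hence a growth rate `2w` common to all
  -- approximants.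
  set l : ℕ → ℝ := fun n => n + (max l₀ (2 * w) + 1) with hldef
  have hl0 : ∀ n, l₀ < l n := fun n => by
    have := le_max_left l₀ (2 * w); have : (0 : ℝ) ≤ n := n.cast_nonneg
    simp only [hldef]; linarith
  have hl2w : ∀ n, 2 * w < l n := fun n => by
    have := le_max_right l₀ (2 * w); have : (0 : ℝ) ≤ n := n.cast_nonneg
    simp only [hldef]; linarith
  have hlw : ∀ n, w < l n := fun n => by linarith [hl2w n]
  have hlpos : ∀ n, 0 < l n := fun n => by linarith [hlw n]
  have hlim : Tendsto l atTop atTop :=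
    tendsto_atTop_add_const_right _ _ tendsto_natCast_atTop_atTop
  have hinj : ∀ m n, m ≠ n → l m ≠ l n := fun m n hmn h =>
    hmn (Nat.cast_injective (add_right_cancel h))
  choose R hR hR' hRn using fun n => exists_resolvent (hlw n) hacc (hsurj (l n) (hl0 n))
  have hD := dense_domain_of_accretive (hlw 0) hacc (hsurj (l 0) (hl0 0))
  -- The Yosida approximants of `-G`: on `D(G)`, `Y n ξ = -(l n) R n (Gξ)`.
  let Y : ℕ → E →L[ℂ] E := fun n => (l n ^ 2) • R n - l n • (1 : E →L[ℂ] E)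
  have hRcomm : ∀ m n, Commute (R m) (R n) := by
    intro m n
    rcases eq_or_ne m n with rfl | hmn
    · exact Commute.refl _
    · exact commute_of_resolvent (hR m) (hR' m) (hR n) (hR' n) (hinj m n hmn)
  have hcomm : ∀ m n, Commute (Y m) (Y n) := fun m n =>
    ((((hRcomm m n).smul_left _).smul_right _).sub_right
      ((Commute.one_right _).smul_right _)).sub_left ((Commute.one_left _).smul_left _)
  have hYbd : ∀ μ : ℝ, (∀ ξ : G.domain, -μ * ‖(ξ : E)‖ ^ 2 ≤ (inner ℂ (ξ : E) (G ξ)).re) →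
      ∀ n, μ < l n → ∀ t : ℝ, 0 ≤ t → ‖exp (t • Y n)‖ ≤ Real.exp (μ * (l n / (l n - μ)) * t) := by
    intro μ hμ n hn t ht
    have h1 : l n - μ ≠ 0 := (sub_pos.mpr hn).ne'
    calc _ ≤ Real.exp (t * (l n ^ 2 * ‖R n‖ - l n)) := norm_exp_smul_sub_le _ (sq_nonneg _) ht
      _ ≤ Real.exp (t * (l n ^ 2 * (l n - μ)⁻¹ - l n)) := by
        gcongr; exact hRn n μ hn hμ
      _ = _ := by congr 1; field_simp; ring
  have hYbd' : ∀ n, ∀ t : ℝ, 0 ≤ t → ‖exp (t • Y n)‖ ≤ Real.exp (w * 2 * t) := by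
    intro n t ht
    refine (hYbd w hacc n (hlw n) t ht).trans ?_
    gcongr
    rw [div_le_iff₀ (sub_pos.mpr (hlw n))]
    linarith [hl2w n]
  have hYlim : ∀ ξ : G.domain, Tendsto (fun n => Y n ξ) atTop (𝓝 (-G ξ)) := by
    intro ξ
    have h1 := (tendsto_smul_resolvent hw hl2w hlim hR' (fun n => hRn n w (hlw n) hacc) hD
      (G ξ)).neg
    refine h1.congr fun n => ?_
    have h2 := hR' n ξ
    rw [map_add, map_smul, ← eq_sub_iff_add_eq] at h2
    rw [h2, smul_sub, neg_sub, smul_smul, ← pow_two, ← Complex.ofReal_pow, Complex.coe_smul,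
      Complex.coe_smul]
    rfl
  obtain ⟨T, ⟨hT0, hTadd, hTcont⟩, hTlim, hTgen⟩ :=
    exists_limit_semigroup hcomm (mul_nonneg hw zero_le_two) hYbd' hD
      (fun x hx => (hYlim ⟨x, hx⟩).cauchySeq)
  have hbound : ∀ μ : ℝ, (∀ ξ : G.domain, -μ * ‖(ξ : E)‖ ^ 2 ≤ (inner ℂ (ξ : E) (G ξ)).re) →
      ∀ t : NNReal, ‖T t‖ ≤ Real.exp (μ * t) := by
    intro μ hμ t
    refine (T t).opNorm_le_bound (Real.exp_pos _).le fun x => ?_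
    -- The approximants grow at rate `μ l / (l - μ)`, which tends to `μ`; the preliminary rate `2w`
    -- leaves no trace in the final bound.
    have hq : Tendsto (fun n => l n / (l n - μ)) atTop (𝓝 1) := by
      have h1 : Tendsto (fun n => 1 + μ * (l n - μ)⁻¹) atTop (𝓝 (1 + μ * 0)) :=
        tendsto_const_nhds.add (tendsto_const_nhds.mul
          (tendsto_inv_atTop_zero.comp (tendsto_atTop_add_const_right _ _ hlim)))
      rw [mul_zero, add_zero] at h1
      refine h1.congr' ?_
      filter_upwards [hlim.eventually_gt_atTop μ] with n hn
      have h2 : l n - μ ≠ 0 := (sub_pos.mpr hn).ne'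
      field_simp
      ring
    have hr : Tendsto (fun n => Real.exp (μ * (l n / (l n - μ)) * t) * ‖x‖) atTop
        (𝓝 (Real.exp (μ * 1 * t) * ‖x‖)) :=
      ((Real.continuous_exp.tendsto _).comp ((hq.const_mul μ).mul_const _)).mul_const _
    rw [mul_one] at hr
    refine le_of_tendsto_of_tendsto (hTlim t x).norm hr ?_
    filter_upwards [hlim.eventually_gt_atTop μ] with n hn
    exact (ContinuousLinearMap.le_opNorm _ _).trans (by gcongr; exact hYbd μ hμ n hn t t.2)
  have hgen : ∀ ξ : G.domain, Tendsto (fun t : NNReal => (((t : ℝ) : ℂ)⁻¹) • ((ξ : E) - T t ξ))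
      (𝓝[>] 0) (𝓝 (G ξ)) := fun ξ => by
    have := hTgen ξ _ (hYlim ξ)
    rwa [neg_neg] at this
  refine ⟨T, ⟨hT0, hTadd, hTcont⟩, fun x y => ⟨fun h => ?_, fun h => ?_⟩, hbound⟩
  · obtain ⟨ξ, hξ1, hξ2⟩ := (LinearPMap.mem_graph_iff G).mp h
    have := hgen ξ
    rwa [hξ1, hξ2] at this
  · exact mem_graph_of_tendsto_difference_quotient (hlw 0) (hbound w hacc) hgen
      (hsurj (l 0) (hl0 0)) h

end Generation

/-! ### The quadratic pencil `A + l² + ilB + C` -/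

section SquareRootEstimates

variable {X : Type*} [NormedAddCommGroup X] [InnerProductSpace ℂ X] [CompleteSpace X]
  {A : X →ₗ.[ℂ] X} (hA : IsStrictlyPositiveSelfAdjoint A)

theorem sqrtOp_sqrtOp (x : A.domain) :
    ∃ h : sqrtOp hA ⟨x, domain_le_sqrtOp_domain hA x.2⟩ ∈ (sqrtOp hA).domain,
      sqrtOp hA ⟨sqrtOp hA ⟨x, domain_le_sqrtOp_domain hA x.2⟩, h⟩ = A x := by
  obtain ⟨ζ, h1, h2⟩ := ((sqrtOp_spec hA).comp_self x (A x)).mp (A.mem_graph x)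
  obtain ⟨z, hz1, hz2⟩ := (LinearPMap.mem_graph_iff _).mp h1
  obtain ⟨y, hy1, hy2⟩ := (LinearPMap.mem_graph_iff _).mp h2
  simp only at hz1 hz2 hy1 hy2
  have hz : z = ⟨x, domain_le_sqrtOp_domain hA x.2⟩ := Subtype.ext hz1
  subst hz
  subst hz2
  exact ⟨hy1 ▸ y.2, by rw [← hy2]; congr 1; exact Subtype.ext hy1.symm⟩

theorem inner_eq_inner_sqrtOp (y : (sqrtOp hA).domain) (x : A.domain) :
    inner ℂ (y : X) (A x) =
      inner ℂ (sqrtOp hA y) (sqrtOp hA ⟨x, domain_le_sqrtOp_domain hA x.2⟩) := by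
  obtain ⟨h, hx⟩ := sqrtOp_sqrtOp hA x
  rw [← hx, ← isSymmetric_of_isSelfAdjoint (sqrtOp_spec hA).isSelfAdjoint]

theorem exists_norm_le_norm_sqrtOp :
    ∃ k : ℝ, 0 ≤ k ∧ ∀ x : (sqrtOp hA).domain, ‖(x : X)‖ ≤ k * ‖sqrtOp hA x‖ := by
  have hS := sqrtOp_spec hA
  obtain ⟨Q, -, hQ⟩ := exists_bounded_inverse hS.isSelfAdjoint hS.nonneg (hS.bijective hA)
  refine ⟨‖Q‖, norm_nonneg _, fun x => ?_⟩
  rw [← (hQ x (sqrtOp hA x)).mp (LinearPMap.mem_graph _ x)]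
  exact Q.le_opNorm _

/-- The cross term is `2l² Re ⟨Ax|x⟩ = 2l²‖A^{1/2}x‖²`. It is what controls `l‖A^{1/2}x‖`, the size
of the leading part of `lBx`. -/
theorem norm_add_sq_smul_sq (x : A.domain) (l : ℝ) :
    ‖A x + ((l ^ 2 : ℝ) : ℂ) • (x : X)‖ ^ 2 =
      ‖A x‖ ^ 2 + 2 * l ^ 2 * ‖sqrtOp hA ⟨x, domain_le_sqrtOp_domain hA x.2⟩‖ ^ 2 +
        l ^ 4 * ‖(x : X)‖ ^ 2 := by
  have h1 : (inner ℂ (A x) (x : X)).re =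
      ‖sqrtOp hA ⟨x, domain_le_sqrtOp_domain hA x.2⟩‖ ^ 2 := by
    have h := inner_eq_inner_sqrtOp hA ⟨x, domain_le_sqrtOp_domain hA x.2⟩ x
    rw [← inner_self_eq_norm_sq (𝕜 := ℂ), ← h, ← inner_conj_symm]
    rfl
  rw [norm_add_sq (𝕜 := ℂ), inner_smul_right, norm_smul, Complex.norm_real,
    Real.norm_of_nonneg (sq_nonneg l)]
  change _ + 2 * (((l ^ 2 : ℝ) : ℂ) * inner ℂ (A x) (x : X)).re + _ = _
  rw [Complex.re_ofReal_mul, h1]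
  ring

theorem norm_perturbation_le {B C : (sqrtOp hA).domain →ₗ[ℂ] X} {a b c d l : ℝ} (ha : 0 ≤ a)
    (ha1 : a < 1) (hB : ∀ ξ : (sqrtOp hA).domain,
      ‖B ξ‖ ^ 2 ≤ a ^ 2 * ‖sqrtOp hA ξ‖ ^ 2 + b ^ 2 * ‖(ξ : X)‖ ^ 2)
    (hC : ∀ ξ : (sqrtOp hA).domain,
      ‖C ξ‖ ^ 2 ≤ c ^ 2 * ‖sqrtOp hA ξ‖ ^ 2 + d ^ 2 * ‖(ξ : X)‖ ^ 2)
    (hl : 1 ≤ l) (hlb : 16 * b ^ 2 ≤ l ^ 2) (hlc : 64 * c ^ 2 ≤ l ^ 2) (hld : 128 * d ^ 2 ≤ l ^ 2)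
    (x : A.domain) :
    ‖(Complex.I * l) • B ⟨x, domain_le_sqrtOp_domain hA x.2⟩ +
        C ⟨x, domain_le_sqrtOp_domain hA x.2⟩‖ ≤
      7 / 8 * ‖A x + ((l ^ 2 : ℝ) : ℂ) • (x : X)‖ := by
  have hh := norm_add_sq_smul_sq hA x l
  set h := ‖A x + ((l ^ 2 : ℝ) : ℂ) • (x : X)‖ with hdef
  have hh0 : 0 ≤ h := norm_nonneg _
  have hBx := hB ⟨x, domain_le_sqrtOp_domain hA x.2⟩
  have hCx := hC ⟨x, domain_le_sqrtOp_domain hA x.2⟩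
  set s := ‖sqrtOp hA ⟨x, domain_le_sqrtOp_domain hA x.2⟩‖ ^ 2
  simp only at hBx hCx
  set n := ‖(x : X)‖ ^ 2 with hn
  set β := ‖B ⟨x, domain_le_sqrtOp_domain hA x.2⟩‖
  set γ := ‖C ⟨x, domain_le_sqrtOp_domain hA x.2⟩‖
  have hs0 : 0 ≤ s := sq_nonneg _
  have hn0 : 0 ≤ n := sq_nonneg _
  have hl2 : 1 ≤ l ^ 2 := one_le_pow₀ hl
  have ha2 : a ^ 2 ≤ 1 := pow_le_one₀ ha ha1.le
  have hA0 : 0 ≤ ‖A x‖ ^ 2 := sq_nonneg _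
  have hls : 0 ≤ l ^ 2 * s := by positivity
  have hln : 0 ≤ l ^ 2 * n := by positivity
  have hl4 : l ^ 4 * n = l ^ 2 * (l ^ 2 * n) := by ring
  -- Since `2l²s + l⁴n ≤ h²`, the bounds `h1` and `h2` give `l²β² ≤ h²/2`, and `1/2 ≤ (3/4)²`.
  have hβ : l * β ≤ 3 / 4 * h := by
    refine le_of_sq_le_sq ?_ (by positivity)
    have h1 : l ^ 2 * (a ^ 2 * s) ≤ l ^ 2 * s := by nlinarith
    have h2 : l ^ 2 * (b ^ 2 * n) ≤ l ^ 4 * n / 16 := by nlinarith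
    have h3 : l ^ 2 * β ^ 2 ≤ l ^ 2 * (a ^ 2 * s + b ^ 2 * n) := by gcongr
    have h4 : 0 ≤ l ^ 4 * n := by positivity
    nlinarith
  -- Here `γ² ≤ (2l²s + l⁴n)/128 ≤ h²/128`; together with `3/4` the total `7/8` stays below `1`.
  have hγ : γ ≤ 1 / 8 * h := by
    refine le_of_sq_le_sq ?_ (by positivity)
    have h1 : c ^ 2 * s ≤ l ^ 2 * s / 64 := by nlinarith
    have h2 : d ^ 2 * n ≤ l ^ 4 * n / 128 := by nlinarith
    have h4 : 0 ≤ l ^ 4 * n := by positivity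
    nlinarith
  refine (norm_add_le _ _).trans ?_
  rw [norm_smul, norm_mul, Complex.norm_I, one_mul, Complex.norm_real,
    Real.norm_of_nonneg (by linarith)]
  linarith

/-- Write `P + K = (1 + KP⁻¹)P`. The hypothesis says `‖KP⁻¹‖ ≤ q < 1`, although `K` itself is not
assumed bounded. -/
theorem surjective_of_norm_le {P : X →L[ℂ] X} (hP : IsUnit P) {K : X →ₗ[ℂ] X} {q : ℝ}
    (hq0 : 0 ≤ q) (hq : q < 1) (hK : ∀ v, ‖K v‖ ≤ q * ‖P v‖) (y : X) : ∃ v, P v + K v = y := by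
  obtain ⟨u, rfl⟩ := hP
  have hinv : ∀ v, (u : X →L[ℂ] X) (((u⁻¹ : (X →L[ℂ] X)ˣ) : X →L[ℂ] X) v) = v := fun v => by
    rw [← mul_apply_eq_comp, Units.mul_inv, one_apply_eq_self]
  let L : X →L[ℂ] X := (-(K.comp ((u⁻¹ : (X →L[ℂ] X)ˣ) : X →L[ℂ] X).toLinearMap)).mkContinuous q
    fun v => by
      change ‖-K (((u⁻¹ : (X →L[ℂ] X)ˣ) : X →L[ℂ] X) v)‖ ≤ q * ‖v‖
      rw [norm_neg]
      exact (hK _).trans_eq (by rw [hinv])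
  have hL : ‖L‖ < 1 := (LinearMap.mkContinuous_norm_le _ hq0 _).trans_lt hq
  set w := Units.oneSub L hL
  set z := ((w⁻¹ : (X →L[ℂ] X)ˣ) : X →L[ℂ] X) y with hz
  refine ⟨((u⁻¹ : (X →L[ℂ] X)ˣ) : X →L[ℂ] X) z, ?_⟩
  have h1 : (w : X →L[ℂ] X) z = y := by
    rw [hz, ← mul_apply_eq_comp, Units.mul_inv, one_apply_eq_self]
  have h2 : (w : X →L[ℂ] X) z = z - -K (((u⁻¹ : (X →L[ℂ] X)ˣ) : X →L[ℂ] X) z) := rfl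
  rw [hinv, ← h1, h2, sub_neg_eq_add]

/-- Positivity of `R` gives `|⟨(1 + kR)x|x⟩| ≥ ‖x‖²`, and a coercive bounded operator is invertible.
-/
theorem isUnit_one_add_smul_of_nonneg {R : X →L[ℂ] X} (hR : 0 ≤ R) {k : ℝ} (hk : 0 ≤ k) :
    IsUnit (1 + (k : ℂ) • R) := by
  refine ContinuousLinearMap.isUnit_of_forall_le_norm_inner_map (𝕜 := ℂ) _ (c := 1) one_pos
    fun x => ?_
  have h1 := ((ContinuousLinearMap.nonneg_iff_isPositive R).mp hR).re_inner_nonneg_left x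
  rw [NNReal.coe_one, mul_one]
  refine le_trans ?_ (Complex.re_le_norm _)
  change _ ≤ (inner ℂ (x + (k : ℂ) • R x) x).re
  rw [inner_add_left, inner_smul_left, Complex.conj_ofReal, Complex.add_re, Complex.re_ofReal_mul]
  have h2 : (inner ℂ x x).re = ‖x‖ ^ 2 := inner_self_eq_norm_sq (𝕜 := ℂ) x
  rw [h2]
  exact le_add_of_nonneg_right (mul_nonneg hk h1)

theorem exists_quadratic_pencil_solution {B C : (sqrtOp hA).domain →ₗ[ℂ] X} {l q : ℝ}
    (hq0 : 0 ≤ q) (hq : q < 1)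
    (hK : ∀ x : A.domain, ‖(Complex.I * l) • B ⟨x, domain_le_sqrtOp_domain hA x.2⟩ +
        C ⟨x, domain_le_sqrtOp_domain hA x.2⟩‖ ≤ q * ‖A x + ((l ^ 2 : ℝ) : ℂ) • (x : X)‖)
    (y : X) :
    ∃ x : A.domain, A x + ((l ^ 2 : ℝ) : ℂ) • (x : X) +
      ((Complex.I * l) • B ⟨x, domain_le_sqrtOp_domain hA x.2⟩ +
        C ⟨x, domain_le_sqrtOp_domain hA x.2⟩) = y := by
  have hpos : ∀ ξ : A.domain, 0 ≤ (inner ℂ (ξ : X) (A ξ)).re := by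
    obtain ⟨ε, hε, h⟩ := hA.bound
    exact fun ξ => le_trans (by positivity) (h ξ)
  obtain ⟨R, hR, hRg⟩ :=
    exists_bounded_inverse hA.isSelfAdjoint hpos ⟨hA.injective, hA.surjective⟩
  let e := LinearEquiv.ofBijective A.toFun ⟨hA.injective, hA.surjective⟩
  have he : ∀ v, A (e.symm v) = v := fun v => e.apply_symm_apply v
  have hRe : ∀ v, R v = (e.symm v : A.domain) := fun v => by
    have := (hRg (e.symm v) (A (e.symm v))).mp (A.mem_graph _)
    rwa [he] at this
  let J := Submodule.inclusion (domain_le_sqrtOp_domain hA)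
  let K : X →ₗ[ℂ] X := (((Complex.I * l) • B + C).comp J).comp e.symm.toLinearMap
  -- The substitution `v = Ax` turns `A + l²` into the bounded operator `1 + l²A⁻¹`, so the equation
  -- can be solved in all of `X`.
  obtain ⟨v, hv⟩ := surjective_of_norm_le (P := 1 + ((l ^ 2 : ℝ) : ℂ) • R)
    (isUnit_one_add_smul_of_nonneg hR (sq_nonneg l)) (K := K) hq0 hq (fun v => by
      have h1 : (1 + ((l ^ 2 : ℝ) : ℂ) • R) v =
          A (e.symm v) + ((l ^ 2 : ℝ) : ℂ) • ((e.symm v : A.domain) : X) := by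
        rw [he, ← hRe]; rfl
      rw [h1]
      exact hK (e.symm v)) y
  refine ⟨e.symm v, ?_⟩
  rw [he]
  change v + ((l ^ 2 : ℝ) : ℂ) • ((e.symm v : A.domain) : X) + K v = y
  rw [← hRe]
  exact hv

end SquareRootEstimates

/-! ### Quasi-accretivity and range of `G₊` -/

section Generator

variable {X : Type*} [NormedAddCommGroup X] [InnerProductSpace ℂ X] [CompleteSpace X]
  {A : X →ₗ.[ℂ] X} (hA : IsStrictlyPositiveSelfAdjoint A)

theorem FormDomain.norm_eq (ξ : FormDomain hA) :
    ‖ξ‖ = ‖sqrtOp hA (FormDomain.toDomain hA ξ)‖ := by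
  have h : ‖ξ‖ ^ 2 = ‖sqrtOp hA (FormDomain.toDomain hA ξ)‖ ^ 2 := by
    rw [← inner_self_eq_norm_sq (𝕜 := ℂ), ← inner_self_eq_norm_sq (𝕜 := ℂ)]
    rfl
  exact (sq_eq_sq₀ (norm_nonneg _) (norm_nonneg _)).mp h

/-- `A^{1/2}` is an isometry of the form domain onto `X`. -/
def FormDomain.isometryEquiv : FormDomain hA ≃ₗᵢ[ℂ] X where
  toLinearEquiv := (FormDomain.toDomain hA).trans
    (LinearEquiv.ofBijective (sqrtOp hA).toFun ((sqrtOp_spec hA).bijective hA))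
  norm_map' ξ := (FormDomain.norm_eq hA ξ).symm

instance : CompleteSpace (FormDomain hA) :=
  (completeSpace_congr (e := (FormDomain.isometryEquiv hA).toEquiv)
    (FormDomain.isometryEquiv hA).isometry.isUniformEmbedding).mpr inferInstance

/-- The element `(x, y)` of `D(G₊) = D(A) × D(A^{1/2})`. -/
def domainGplusMk (B C : (sqrtOp hA).domain →ₗ[ℂ] X) (x : A.domain) (y : (sqrtOp hA).domain) :
    (opGplus hA B C).domain :=
  ⟨pairY hA (⟨x, domain_le_sqrtOp_domain hA x.2⟩, y), by
    rw [opGplus_domain]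
    exact ⟨x.2, y.2⟩⟩

variable {hA} (B C : (sqrtOp hA).domain →ₗ[ℂ] X)

theorem exists_eq_domainGplusMk (ξ : (opGplus hA B C).domain) :
    ∃ x y, ξ = domainGplusMk hA B C x y := by
  have h : (ξ : EnergySpace hA) ∈ domainH hA := opGplus_domain hA B C ▸ ξ.2
  exact ⟨⟨_, h.1⟩, ⟨_, h.2⟩, rfl⟩

theorem opGplus_domainGplusMk (x : A.domain) (y : (sqrtOp hA).domain) :
    opGplus hA B C (domainGplusMk hA B C x y) =
      pairY hA (-y, A x + Complex.I • B y + C ⟨x, domain_le_sqrtOp_domain hA x.2⟩) := by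
  have h : opGplus hA B C (domainGplusMk hA B C x y) =
      (-Complex.I) • (pairY hA ((-Complex.I) • y, Complex.I • A x) + pairY hA (0, -B y) +
        pairY hA (0, Complex.I • C ⟨x, domain_le_sqrtOp_domain hA x.2⟩)) := rfl
  rw [h, ← map_add, ← map_add, ← map_smul]
  congr 1
  refine Prod.ext ?_ ?_
  · change (-Complex.I) • ((-Complex.I) • y + 0 + 0) = -y
    rw [add_zero, add_zero, smul_smul, neg_mul_neg, Complex.I_mul_I, neg_one_smul]
  · change (-Complex.I) • (Complex.I • A x + -B y + Complex.I • C _) = _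
    rw [smul_add, smul_add, smul_smul, smul_smul, smul_neg, neg_mul, Complex.I_mul_I, neg_neg,
      one_smul, one_smul, neg_smul, neg_neg]

theorem norm_sq_pairY (x : (sqrtOp hA).domain) (y : X) :
    ‖pairY hA (x, y)‖ ^ 2 = ‖sqrtOp hA x‖ ^ 2 + ‖y‖ ^ 2 := by
  rw [WithLp.prod_norm_sq_eq_of_L2, FormDomain.norm_eq]
  rfl

theorem exists_quasiAccretive_opGplus {c d : ℝ} (hC : ∀ ξ : (sqrtOp hA).domain,
      ‖C ξ‖ ^ 2 ≤ c ^ 2 * ‖sqrtOp hA ξ‖ ^ 2 + d ^ 2 * ‖(ξ : X)‖ ^ 2)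
    (hiB : IsQuasiAccretive (⟨(sqrtOp hA).domain, Complex.I • B⟩ : X →ₗ.[ℂ] X)) :
    ∃ w : ℝ, 0 ≤ w ∧ ∀ ξ : (opGplus hA B C).domain,
      -w * ‖(ξ : EnergySpace hA)‖ ^ 2 ≤
        (inner ℂ (ξ : EnergySpace hA) (opGplus hA B C ξ)).re := by
  obtain ⟨k, hk0, hk⟩ := exists_norm_le_norm_sqrtOp hA
  obtain ⟨ω, hω⟩ := hiB
  have hCk : ∀ ξ : (sqrtOp hA).domain, ‖C ξ‖ ^ 2 ≤ (c ^ 2 + d ^ 2 * k ^ 2) * ‖sqrtOp hA ξ‖ ^ 2 := by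
    intro ξ
    refine (hC ξ).trans ?_
    have h : ‖(ξ : X)‖ ^ 2 ≤ (k * ‖sqrtOp hA ξ‖) ^ 2 := by gcongr; exact hk ξ
    nlinarith [sq_nonneg d, mul_le_mul_of_nonneg_left h (sq_nonneg d)]
  set κ := c ^ 2 + d ^ 2 * k ^ 2 with hκ
  have hκ0 : 0 ≤ κ := by positivity
  -- `|ω|` pays for `iB`; `‖y‖‖Cx‖ ≤ ‖y‖² + κ‖A^{1/2}x‖²` accounts for `1` and `κ`.
  refine ⟨|ω| + κ + 1, by positivity, fun ξ => ?_⟩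
  obtain ⟨x, y, rfl⟩ := exists_eq_domainGplusMk B C ξ
  set x' : (sqrtOp hA).domain := ⟨x, domain_le_sqrtOp_domain hA x.2⟩ with hx'
  have hval : ((domainGplusMk hA B C x y : (opGplus hA B C).domain) : EnergySpace hA) =
      pairY hA (x', (y : X)) := rfl
  rw [opGplus_domainGplusMk, hval, norm_sq_pairY]
  have hin : inner ℂ (pairY hA (x', (y : X))) (pairY hA (-y, A x + Complex.I • B y + C x')) =
      inner ℂ (sqrtOp hA x') (sqrtOp hA (-y)) + inner ℂ (y : X) (A x + Complex.I • B y + C x') :=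
    rfl
  -- `⟨y|Ax⟩ = ⟨A^{1/2}y|A^{1/2}x⟩` is the conjugate of `⟨A^{1/2}x|A^{1/2}y⟩`, so the two terms
  -- cancel in the real part.
  rw [hin, LinearPMap.map_neg, inner_neg_right, inner_add_right, inner_add_right,
    inner_eq_inner_sqrtOp, ← inner_conj_symm (sqrtOp hA x') (sqrtOp hA y)]
  simp only [Complex.add_re, Complex.neg_re, Complex.conj_re]
  have h1 : -ω * ‖(y : X)‖ ^ 2 ≤ (inner ℂ (y : X) (Complex.I • B y)).re := hω y
  have h2 : -(‖(y : X)‖ * ‖C x'‖) ≤ (inner ℂ (y : X) (C x')).re :=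
    neg_le_of_neg_le (by
      rw [← Complex.neg_re, ← inner_neg_right, ← norm_neg (C x')]
      exact (Complex.re_le_norm _).trans (norm_inner_le_norm _ _))
  have h3 := hCk x'
  have h4 : ω * ‖(y : X)‖ ^ 2 ≤ |ω| * ‖(y : X)‖ ^ 2 := by gcongr; exact le_abs_self ω
  have h5 : ‖(y : X)‖ * ‖C x'‖ ≤ ‖(y : X)‖ ^ 2 + ‖C x'‖ ^ 2 := by
    nlinarith [sq_nonneg (‖(y : X)‖ - ‖C x'‖), sq_nonneg ‖(y : X)‖, sq_nonneg ‖C x'‖]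
  have h6 : 0 ≤ (|ω| + 1) * ‖sqrtOp hA x'‖ ^ 2 := by positivity
  have h7 : 0 ≤ κ * ‖(y : X)‖ ^ 2 := by positivity
  linarith

theorem exists_surjective_opGplus_add {a b c d : ℝ} (ha : 0 ≤ a) (ha1 : a < 1)
    (hB : ∀ ξ : (sqrtOp hA).domain,
      ‖B ξ‖ ^ 2 ≤ a ^ 2 * ‖sqrtOp hA ξ‖ ^ 2 + b ^ 2 * ‖(ξ : X)‖ ^ 2)
    (hC : ∀ ξ : (sqrtOp hA).domain,
      ‖C ξ‖ ^ 2 ≤ c ^ 2 * ‖sqrtOp hA ξ‖ ^ 2 + d ^ 2 * ‖(ξ : X)‖ ^ 2) :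
    ∃ l₀ : ℝ, ∀ l : ℝ, l₀ < l → ∀ η : EnergySpace hA, ∃ ξ : (opGplus hA B C).domain,
      opGplus hA B C ξ + (l : ℂ) • (ξ : EnergySpace hA) = η := by
  -- Beyond this threshold `l ≥ 1`, hence `l² ≥ l` dominates each of the three terms as
  -- `norm_perturbation_le` requires.
  refine ⟨1 + 16 * b ^ 2 + 64 * c ^ 2 + 128 * d ^ 2, fun l hl η => ?_⟩
  have hb := sq_nonneg b
  have hc := sq_nonneg c
  have hd := sq_nonneg d
  have hl1 : 1 ≤ l := by linarith
  have hll : l ≤ l ^ 2 := by nlinarith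
  obtain ⟨⟨f, g⟩, rfl⟩ : ∃ p, pairY hA p = η :=
    ⟨(FormDomain.toDomain hA η.fst, η.snd), rfl⟩
  obtain ⟨x, hx⟩ := exists_quadratic_pencil_solution hA (q := 7 / 8) (by norm_num) (by norm_num)
    (norm_perturbation_le hA ha ha1 hB hC hl1 (by linarith) (by linarith) (by linarith))
    (g + (l : ℂ) • (f : X) + Complex.I • B f)
  set x' : (sqrtOp hA).domain := ⟨x, domain_le_sqrtOp_domain hA x.2⟩ with hx'
  -- The first component `-y + lx = f` dictates `y = lx - f`; the second is then the pencil equation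
  -- for `x`.
  refine ⟨domainGplusMk hA B C x ((l : ℂ) • x' - f), ?_⟩
  have hval : ∀ y, ((domainGplusMk hA B C x y : (opGplus hA B C).domain) : EnergySpace hA) =
      pairY hA (x', (y : X)) := fun _ => rfl
  rw [opGplus_domainGplusMk, hval, ← (pairY hA).map_smul, ← (pairY hA).map_add]
  congr 1
  refine Prod.ext ?_ ?_
  · change -((l : ℂ) • x' - f) + (l : ℂ) • x' = f
    abel
  · change A x + Complex.I • B ((l : ℂ) • x' - f) + C x' + (l : ℂ) • ((l : ℂ) • (x : X) - f) = g
    rw [map_sub, map_smul]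
    have hl2 : ((l ^ 2 : ℝ) : ℂ) = (l : ℂ) * l := by push_cast; ring
    rw [hl2] at hx
    linear_combination (norm := module) (1 : ℂ) • hx

end Generator

end SecondOrderEvolution

end

theorem corollary8 {X : Type*} [NormedAddCommGroup X] [InnerProductSpace ℂ X] [CompleteSpace X]
    [Nontrivial X]
    (A : X →ₗ.[ℂ] X) (hA : SecondOrderEvolution.IsStrictlyPositiveSelfAdjoint A)
    (B C : (SecondOrderEvolution.sqrtOp hA).domain →ₗ[ℂ] X)
    (hB : ∃ a b : ℝ, 0 ≤ a ∧ a < 1 ∧ ∀ ξ : (SecondOrderEvolution.sqrtOp hA).domain,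
      ‖B ξ‖ ^ 2 ≤ a ^ 2 * ‖SecondOrderEvolution.sqrtOp hA ξ‖ ^ 2 + b ^ 2 * ‖(ξ : X)‖ ^ 2)
    (hC : ∃ c d : ℝ, ∀ ξ : (SecondOrderEvolution.sqrtOp hA).domain,
      ‖C ξ‖ ^ 2 ≤ c ^ 2 * ‖SecondOrderEvolution.sqrtOp hA ξ‖ ^ 2 + d ^ 2 * ‖(ξ : X)‖ ^ 2)
    (hiB : SecondOrderEvolution.IsQuasiAccretive
      (⟨(SecondOrderEvolution.sqrtOp hA).domain, Complex.I • B⟩ : X →ₗ.[ℂ] X)) :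
    ∃ T : NNReal → SecondOrderEvolution.EnergySpace hA →L[ℂ] SecondOrderEvolution.EnergySpace hA,
      SecondOrderEvolution.IsStronglyContinuousSemigroup T ∧
      SecondOrderEvolution.IsInfinitesimalGenerator
        (SecondOrderEvolution.opGplus hA B C) T ∧
      ∀ μ : ℝ,
        (∀ ξ : (SecondOrderEvolution.opGplus hA B C).domain,
          -μ * (inner ℂ (ξ : SecondOrderEvolution.EnergySpace hA)
              (ξ : SecondOrderEvolution.EnergySpace hA)).re ≤
            (inner ℂ (ξ : SecondOrderEvolution.EnergySpace hA)
              (SecondOrderEvolution.opGplus hA B C ξ)).re) →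
        SecondOrderEvolution.opSpectrum (SecondOrderEvolution.opGplus hA B C) ⊆
            {z : ℂ | -μ ≤ z.re} ∧
          ∀ t : NNReal, ‖T t‖ ≤ Real.exp (μ * t) := by

  obtain ⟨a, b, ha, ha1, hB⟩ := hB
  obtain ⟨c, d, hC⟩ := hC
  obtain ⟨w, hw, hacc⟩ := SecondOrderEvolution.exists_quasiAccretive_opGplus B C hC hiB
  obtain ⟨l₀, hsurj⟩ := SecondOrderEvolution.exists_surjective_opGplus_add B C ha ha1 hB hC
  obtain ⟨T, hT, hgen, hbound⟩ :=
    SecondOrderEvolution.exists_semigroup_of_accretive hw hacc hsurj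
  refine ⟨T, hT, hgen, fun μ hμ => ?_⟩
  have hμ' : ∀ ξ : (SecondOrderEvolution.opGplus hA B C).domain,
      -μ * ‖(ξ : SecondOrderEvolution.EnergySpace hA)‖ ^ 2 ≤
        (inner ℂ (ξ : SecondOrderEvolution.EnergySpace hA)
          (SecondOrderEvolution.opGplus hA B C ξ)).re := fun ξ => by
    rw [← inner_self_eq_norm_sq (𝕜 := ℂ)]
    exact hμ ξ
  exact ⟨SecondOrderEvolution.opSpectrum_subset_of_accretive hμ' hsurj, hbound μ hμ'⟩
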